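/- Let $d \ge 0$ be an integer and let $V : \mathbb{R}^d \to \mathbb{R}$ satisfy: - (V1) $V$ is smooth and nonnegative; - (V2) for every integer $k \ge 2$ there is a constant $M_k$ with $\|\partial_x^k V\|_{L^\infty} \le M_k$; - (V3) there is $\delta > 0$ such that $V(x) \ge \delta |x|^2$ for all $x \in \mathbb{R}^d$. Let $H = -\tfrac12 \Delta + V$ be the operator in $L^2(\mathbb{R}^d;\mathbb{C})$ associated with the quadratic form \[ a(u,v) = \tfrac12 \int_{\mathbb{R}^d} \nabla u \cdot \overline{\nabla v}\, dx + \int_{\mathbb{R}^d} V u \overline{v}\, dx \] on the form domain $Q(H) = \{ u \in L^2 : \nabla u \in L^2,\ V^{1/2} u \in L^2 \}$ (weak gradient); that is, $u \in D(H)$ and $Hu = w \in L^2$ if and only if $u \in Q(H)$ and $a(u,v) = \int w \overline{v}\, dx$ for all $v \in Q(H)$. Let $D(H^0) = L^2$ and $D(H^{n+1}) = \{u \in D(H) : Hu \in D(H^n)\}$. Then the space of smooth vectors for $H$ is precisely the Schwartz class: \[ D(H^\infty) := \bigcap_{n \ge 0} D(H^n) = \mathcal{S}(\mathbb{R}^d),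 \] where $\mathcal{S}(\mathbb{R}^d)$, the space of complex-valued Schwartz functions, is regarded as a subspace of $L^2(\mathbb{R}^d;\mathbb{C})$. -/

import Mathlib

open MeasureTheory SchwartzMap LineDeriv
open scoped ContDiff ENNReal

/-- Hypotheses on a real potential `V` on `ℝ^d`: it is smooth and nonnegative, all its derivatives
of order at least two are bounded, and it grows at least quadratically. -/
structure IsSubquadraticConfining {d : ℕ} (V : EuclideanSpace ℝ (Fin d) → ℝ) : Prop where
  smooth : ContDiff ℝ ∞ V
  nonneg : ∀ x, 0 ≤ V x
  bounded_deriv : ∀ k : ℕ, 2 ≤ k → ∃ M : ℝ, ∀ x, ‖iteratedFDeriv ℝ k V x‖ ≤ M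
  coercive : ∃ δ : ℝ, 0 < δ ∧ ∀ x, δ * ‖x‖ ^ 2 ≤ V x

/-- The Hilbert space `L²(ℝ^d; ℂ)`. -/
abbrev L2Space (d : ℕ) : Type :=
  Lp ℂ 2 (volume : Measure (EuclideanSpace ℝ (Fin d)))

/-- The graph of the weak partial derivative `∂_j` in `L²`: the pairs `(u, g)` of `L²` functions
for which `∂_j u = g` in the sense of tempered distributions. -/
def weakPartialGraph {d : ℕ} (j : Fin d) : Submodule ℂ (L2Space d × L2Space d) where
  carrier := {p | ∂_{EuclideanSpace.single j (1 : ℝ)}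
      (Lp.toTemperedDistributionCLM ℂ volume 2 p.1) = Lp.toTemperedDistributionCLM ℂ volume 2 p.2}
  add_mem' {p q} hp hq := by
    simp only [Set.mem_ofPred_eq, Prod.fst_add, Prod.snd_add, map_add, lineDerivOp_add] at *
    rw [hp, hq]
  zero_mem' := by
    simp only [Set.mem_ofPred_eq, Prod.fst_zero, Prod.snd_zero, map_zero, lineDerivOp_zero]
  smul_mem' c p hp := by
    simp only [Set.mem_ofPred_eq, Prod.smul_fst, Prod.smul_snd, map_smul, lineDerivOp_smul] at *
    rw [hp]

theorem mem_weakPartialGraph {d : ℕ} (j : Fin d) (u g : L2Space d) :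
    (u, g) ∈ weakPartialGraph j ↔ ∂_{EuclideanSpace.single j (1 : ℝ)}
      (Lp.toTemperedDistributionCLM ℂ volume 2 u) = Lp.toTemperedDistributionCLM ℂ volume 2 g :=
  Iff.rfl

theorem weakPartialGraph_functional {d : ℕ} (j : Fin d) :
    ∀ p ∈ weakPartialGraph j, p.1 = 0 → p.2 = 0 := by
  intro p hp h0
  have hp' : ∂_{EuclideanSpace.single j (1 : ℝ)}
      (Lp.toTemperedDistributionCLM ℂ volume 2 p.1) =
      Lp.toTemperedDistributionCLM ℂ volume 2 p.2 := hp
  rw [h0, map_zero, lineDerivOp_zero] at hp'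
  have hk : p.2 ∈ (Lp.toTemperedDistributionCLM (E := EuclideanSpace ℝ (Fin d)) ℂ volume 2).ker :=
    hp'.symm
  rw [Lp.ker_toTemperedDistributionCLM_eq_bot] at hk
  exact hk

/-- The weak partial derivative `∂_j` as an operator in `L²` with its maximal domain. -/
noncomputable def weakPartial {d : ℕ} (j : Fin d) : L2Space d →ₗ.[ℂ] L2Space d :=
  (weakPartialGraph j).toLinearPMap

theorem weakPartial_graph {d : ℕ} (j : Fin d) : (weakPartial j).graph = weakPartialGraph j :=
  Submodule.toLinearPMap_graph_eq _ (weakPartialGraph_functional j)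

/-- The graph of multiplication by the real function `m` in `L²`. -/
def mulGraph {d : ℕ} (m : EuclideanSpace ℝ (Fin d) → ℝ) :
    Submodule ℂ (L2Space d × L2Space d) where
  carrier := {p | ∀ᵐ x, p.2 x = (m x : ℂ) * p.1 x}
  add_mem' {p q} hp hq := by
    simp only [Set.mem_ofPred_eq, Prod.fst_add, Prod.snd_add] at *
    filter_upwards [hp, hq, Lp.coeFn_add p.1 q.1, Lp.coeFn_add p.2 q.2] with x h1 h2 h3 h4
    rw [h3, h4, Pi.add_apply, Pi.add_apply, h1, h2, mul_add]
  zero_mem' := by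
    simp only [Set.mem_ofPred_eq, Prod.fst_zero, Prod.snd_zero]
    filter_upwards [Lp.coeFn_zero ℂ 2 (volume : Measure (EuclideanSpace ℝ (Fin d)))] with x h
    rw [h]
    simp
  smul_mem' c p hp := by
    simp only [Set.mem_ofPred_eq, Prod.smul_fst, Prod.smul_snd] at *
    filter_upwards [hp, Lp.coeFn_smul c p.1, Lp.coeFn_smul c p.2] with x h1 h2 h3
    rw [h2, h3, Pi.smul_apply, Pi.smul_apply, h1, smul_eq_mul, smul_eq_mul]
    ring

theorem mem_mulGraph {d : ℕ} (m : EuclideanSpace ℝ (Fin d) → ℝ) (u w : L2Space d) :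
    (u, w) ∈ mulGraph m ↔ ∀ᵐ x, w x = (m x : ℂ) * u x :=
  Iff.rfl

theorem mulGraph_functional {d : ℕ} (m : EuclideanSpace ℝ (Fin d) → ℝ) :
    ∀ p ∈ mulGraph m, p.1 = 0 → p.2 = 0 := by
  intro p hp h0
  have hp' : ∀ᵐ x, p.2 x = (m x : ℂ) * p.1 x := hp
  rw [h0] at hp'
  rw [Lp.eq_zero_iff_ae_eq_zero]
  filter_upwards [hp', Lp.coeFn_zero ℂ 2 (volume : Measure (EuclideanSpace ℝ (Fin d)))] with x h1 h2
  rw [h1, h2]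
  simp

/-- Multiplication by the real function `m` as an operator in `L²` with its maximal domain. -/
noncomputable def mulOperator {d : ℕ} (m : EuclideanSpace ℝ (Fin d) → ℝ) :
    L2Space d →ₗ.[ℂ] L2Space d :=
  (mulGraph m).toLinearPMap

theorem mulOperator_graph {d : ℕ} (m : EuclideanSpace ℝ (Fin d) → ℝ) :
    (mulOperator m).graph = mulGraph m :=
  Submodule.toLinearPMap_graph_eq _ (mulGraph_functional m)

/-- The form domain of `-½Δ + V` (for `V ≥ 0`): all `u ∈ L²` with weak gradient in `L²` and
`V^{1/2} u ∈ L²`. -/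
noncomputable def formDomain {d : ℕ} (V : EuclideanSpace ℝ (Fin d) → ℝ) :
    Submodule ℂ (L2Space d) :=
  (⨅ j : Fin d, (weakPartial j).domain) ⊓ (mulOperator fun x => √(V x)).domain

/-- The weak partial derivative `∂_j u` of an element `u` of the form domain. -/
noncomputable def formPartial {d : ℕ} (V : EuclideanSpace ℝ (Fin d) → ℝ) (j : Fin d) :
    formDomain V →ₗ[ℂ] L2Space d :=
  (weakPartial j).toFun ∘ₗ
    Submodule.inclusion (inf_le_left.trans (iInf_le (fun j => (weakPartial j).domain) j))

/-- The function `V^{1/2} u` for an element `u` of the form domain. -/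
noncomputable def formSqrtPotential {d : ℕ} (V : EuclideanSpace ℝ (Fin d) → ℝ) :
    formDomain V →ₗ[ℂ] L2Space d :=
  (mulOperator fun x => √(V x)).toFun ∘ₗ Submodule.inclusion inf_le_right

/-- The quadratic form of `-½Δ + V` (for `V ≥ 0`), antilinear in the first variable:
`½ ∑_j ⟪∂_j v, ∂_j u⟫ + ⟪V^{1/2} v, V^{1/2} u⟫`. -/
noncomputable def energyForm {d : ℕ} (V : EuclideanSpace ℝ (Fin d) → ℝ) (v u : formDomain V) : ℂ :=
  (1 / 2 : ℂ) * ∑ j : Fin d, inner ℂ (formPartial V j v) (formPartial V j u)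
    + inner ℂ (formSqrtPotential V v) (formSqrtPotential V u)

/-- The graph of the operator of the form: pairs `(u, w)` with `u` in the form domain and
`energyForm V v u = ⟪v, w⟫` for every `v` in the form domain. -/
def schrodingerGraph {d : ℕ} (V : EuclideanSpace ℝ (Fin d) → ℝ) :
    Submodule ℂ (L2Space d × L2Space d) where
  carrier := {p | ∃ hu : p.1 ∈ formDomain V, ∀ v : formDomain V,
    energyForm V v ⟨p.1, hu⟩ = inner ℂ (v : L2Space d) p.2}
  add_mem' {p q} := by
    rintro ⟨hp, hp'⟩ ⟨hq, hq'⟩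
    refine ⟨(formDomain V).add_mem hp hq, fun v => ?_⟩
    have h : (⟨(p + q).1, (formDomain V).add_mem hp hq⟩ : formDomain V) = ⟨p.1, hp⟩ + ⟨q.1, hq⟩ :=
      rfl
    rw [h, Prod.snd_add, inner_add_right, ← hp' v, ← hq' v]
    simp only [energyForm, map_add, inner_add_right, Finset.sum_add_distrib]
    ring
  zero_mem' := by
    refine ⟨(formDomain V).zero_mem, fun v => ?_⟩
    have h : (⟨(0 : L2Space d × L2Space d).1, (formDomain V).zero_mem⟩ : formDomain V) = 0 := rfl
    rw [h]
    simp [energyForm]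
  smul_mem' c p := by
    rintro ⟨hp, hp'⟩
    refine ⟨(formDomain V).smul_mem c hp, fun v => ?_⟩
    have h : (⟨(c • p).1, (formDomain V).smul_mem c hp⟩ : formDomain V) = c • ⟨p.1, hp⟩ := rfl
    rw [h, Prod.smul_snd, inner_smul_right, ← hp' v]
    simp only [energyForm, map_smul, inner_smul_right, ← Finset.mul_sum]
    ring

/-- The operator `H = -½Δ + V` (for `V ≥ 0`): the operator in `L²` associated with `energyForm V`,
that is, `u ∈ D(H)` and `H u = w` iff `u` is in the form domain and
`energyForm V v u = ⟪v, w⟫` for every `v` in the form domain. -/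
noncomputable def schrodingerOperator {d : ℕ} (V : EuclideanSpace ℝ (Fin d) → ℝ) :
    L2Space d →ₗ.[ℂ] L2Space d :=
  (schrodingerGraph V).toLinearPMap

/-- Smooth compactly supported functions belong to the form domain. -/
theorem toLp_mem_formDomain {d : ℕ} {V : EuclideanSpace ℝ (Fin d) → ℝ} (hV : Continuous V)
    (f : 𝓢(EuclideanSpace ℝ (Fin d), ℂ)) (hf : HasCompactSupport f) :
    f.toLp 2 volume ∈ formDomain V := by
  refine ⟨?_, ?_⟩
  · rw [SetLike.mem_coe, Submodule.mem_iInf]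
    intro j
    refine LinearPMap.mem_domain_of_mem_graph
      (y := (∂_{EuclideanSpace.single j (1 : ℝ)} f).toLp 2 volume) ?_
    rw [weakPartial_graph, mem_weakPartialGraph, Lp.toTemperedDistributionCLM_apply,
      Lp.toTemperedDistributionCLM_apply, Lp.toTemperedDistribution_toLp_eq,
      Lp.toTemperedDistribution_toLp_eq]
    exact TemperedDistribution.lineDerivOp_toTemperedDistributionCLM_eq f _
  · have hc : Continuous fun x => ((√(V x) : ℝ) : ℂ) * f x := by
      have := f.continuous
      fun_prop
    have hm : MemLp (fun x => ((√(V x) : ℝ) : ℂ) * f x) 2 volume :=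
      hc.memLp_of_hasCompactSupport hf.mul_left
    refine LinearPMap.mem_domain_of_mem_graph (y := hm.toLp _) ?_
    rw [mulOperator_graph, mem_mulGraph]
    filter_upwards [hm.coeFn_toLp, f.coeFn_toLp 2 volume] with x h1 h2
    rw [h1, h2]

theorem dense_formDomain {d : ℕ} {V : EuclideanSpace ℝ (Fin d) → ℝ} (hV : Continuous V) :
    Dense (formDomain V : Set (L2Space d)) := by
  intro f
  refine (mem_closure_iff_nhds_basis Metric.nhds_basis_closedBall).2 fun ε hε => ?_
  obtain ⟨g, hg₁, hg₂, hg₃⟩ :=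
    MemLp.exist_eLpNorm_sub_le (by norm_num) one_le_two (Lp.memLp f) hε
  refine ⟨(hg₁.toSchwartzMap hg₂).toLp 2 volume, toLp_mem_formDomain hV _ hg₁, ?_⟩
  have : (f : EuclideanSpace ℝ (Fin d) → ℂ) - ((hg₁.toSchwartzMap hg₂).toLp 2 volume :
      EuclideanSpace ℝ (Fin d) → ℂ) =ᵐ[volume] (f : EuclideanSpace ℝ (Fin d) → ℂ) - g := by
    filter_upwards [(hg₁.toSchwartzMap hg₂).coeFn_toLp 2 volume]
    simp
  simp only [Metric.mem_closedBall', Lp.dist_def, eLpNorm_congr_ae this]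
  grw [hg₃, ENNReal.toReal_ofReal hε.le]
  simp

/-- The graph above is the graph of a (single-valued) operator, so that `schrodingerOperator V`
really has this graph. -/
theorem schrodingerOperator_graph {d : ℕ} {V : EuclideanSpace ℝ (Fin d) → ℝ} (hV : Continuous V) :
    (schrodingerOperator V).graph = schrodingerGraph V := by
  refine Submodule.toLinearPMap_graph_eq _ ?_
  rintro ⟨u, w⟩ ⟨hu, h⟩ h0
  simp only at hu h h0 ⊢
  subst h0
  refine (dense_formDomain hV).eq_zero_of_inner_right ℂ fun v hv => ?_
  have h2 : (⟨0, hu⟩ : formDomain V) = 0 := rfl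
  rw [← h ⟨v, hv⟩, h2]
  simp [energyForm]

/-- The domain of the power `T ^ n` of a partially defined operator: `D(T ^ 0)` is the whole space
and `D(T ^ (n + 1))` consists of the `u ∈ D(T)` with `T u ∈ D(T ^ n)`. -/
def powDomain {E : Type*} [AddCommGroup E] [Module ℂ E] (T : E →ₗ.[ℂ] E) : ℕ → Submodule ℂ E
  | 0 => ⊤
  | n + 1 => ((powDomain T n).comap T.toFun).map T.domain.subtype

theorem mem_powDomain_succ {E : Type*} [AddCommGroup E] [Module ℂ E] (T : E →ₗ.[ℂ] E) (n : ℕ)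
    (u : E) : u ∈ powDomain T (n + 1) ↔ ∃ hu : u ∈ T.domain, T ⟨u, hu⟩ ∈ powDomain T n := by
  simp [powDomain]

/-!
# Smooth vectors of a confining Schrödinger operator are the Schwartz functions

Write `H = -½Δ + V`. Testing the form identity against Schwartz functions shows that the form
operator acts as `H` in the sense of distributions (`distSchrodinger_eq_of_mem_graph`), and that
Schwartz functions lie in its domain and are mapped to Schwartz functions
(`schwartz_mem_schrodingerGraph`). Hence Schwartz functions are smooth vectors. The content is the
converse.

It rests on elliptic regularity in the scale `oscillatorSpace` of the harmonic oscillator: the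
`k`-th space consists of the distributions that stay in `L²` under all products of at most `k` of
the operators `∂_j` and `x_j`. The claim is that if `T` and `HT` are both in the `k`-th space then
`T` is in the next one (`mem_oscillatorSpace_succ_of_distSchrodinger`). A smooth vector `u` has a smooth
vector as its image `Hu`, so an induction on `k` puts all smooth vectors in all spaces of the scale.

For `k = 0` the claim is the energy estimate: for a cutoff function `χ`, pairing the equation
satisfied by `χT` with `χT` bounds `½‖∇(χT)‖² + ∫ V|χT|²` by quantities that do not depend on the
support of `χ` (`energy_cutoff_le`), and the coercivity `V ≥ δ|x|²` turns this into bounds on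
`∂_j(χT)` and `x_jχT`, which survive in the weak limit `χ → 1`
(`gradient_coord_mem_squareIntegrable`). The product `χT` is in `H¹` because its Laplacian is in
`H⁻¹`, and the integration by parts is Plancherel's theorem (`exists_gradient_energy_eq`). The step
from `k` to `k + 1` uses the commutators `[H, x_j] = -∂_j` and `[H, ∂_j] = -(∂_jV)`. As the second
derivatives of `V` and all higher ones are bounded, `∂_jV` has at most linear growth, and
multiplication by it costs one order in the scale (`smulLeftCLM_mem_oscillatorSpace_of_succ`).

Finally, an element of all spaces of the scale is a Schwartz function
(`exists_schwartzMap_of_mem_oscillatorSmooth`): it lies in all Sobolev spaces, so its Fourier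
transform is integrable and it is a bounded continuous function. The same applies to all its
derivatives and their products with polynomials, and differentiation under the Fourier integral
identifies the distributional derivatives with the classical ones.
-/

/-! ### Tempered distributions given by functions -/

open TemperedDistribution in
/-- The Leibniz rule for the product of a tempered distribution with a function of temperate
growth. -/
theorem TemperedDistribution.lineDerivOp_smulLeftCLM {E : Type*} [NormedAddCommGroup E]
    [NormedSpace ℝ E] {g : E → ℂ} (hg : g.HasTemperateGrowth) (m : E)
    (hg' : (fun x => fderiv ℝ g x m).HasTemperateGrowth) (T : 𝓢'(E, ℂ)) :
    ∂_{m} (smulLeftCLM ℂ g T) =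
      smulLeftCLM ℂ g (∂_{m} T) + smulLeftCLM ℂ (fun x => fderiv ℝ g x m) T := by
  ext φ
  have key : SchwartzMap.smulLeftCLM ℂ g (-∂_{m} φ) =
      -∂_{m} (SchwartzMap.smulLeftCLM ℂ g φ) +
        SchwartzMap.smulLeftCLM ℂ (fun x => fderiv ℝ g x m) φ := by
    ext x
    have h : fderiv ℝ (SchwartzMap.smulLeftCLM ℂ g φ) x m
        = g x * fderiv ℝ φ x m + fderiv ℝ g x m * φ x := by
      rw [SchwartzMap.smulLeftCLM_apply hg]
      simp only [smul_eq_mul]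
      rw [fderiv_fun_mul (hg.1.differentiable (by simp)).differentiableAt φ.differentiableAt]
      simp [mul_comm]
    simp only [map_neg, add_apply, neg_apply, SchwartzMap.smulLeftCLM_apply_apply hg,
      SchwartzMap.smulLeftCLM_apply_apply hg', lineDerivOp_apply_eq_fderiv, h, smul_eq_mul]
    ring
  simp only [lineDerivOp_apply_apply, smulLeftCLM_apply_apply, key, add_apply, map_add]

/-- The locally integrable function `f` represents the tempered distribution `T`: every test
function is integrable against `f`, with value that of `T`. -/
structure Represents {d : ℕ} (f : EuclideanSpace ℝ (Fin d) → ℂ)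
    (T : 𝓢'(EuclideanSpace ℝ (Fin d), ℂ)) : Prop where
  locallyIntegrable : LocallyIntegrable f
  integrable : ∀ φ : 𝓢(EuclideanSpace ℝ (Fin d), ℂ), Integrable fun x => φ x * f x
  apply_eq : ∀ φ : 𝓢(EuclideanSpace ℝ (Fin d), ℂ), T φ = ∫ x, φ x * f x

namespace Represents

variable {d : ℕ} {f f' : EuclideanSpace ℝ (Fin d) → ℂ} {T T' : 𝓢'(EuclideanSpace ℝ (Fin d), ℂ)}

/-- A distribution has at most one representing function, up to null sets: smooth compactly
supported functions separate locally integrable functions. -/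
theorem ae_eq (h : Represents f T) (h' : Represents f' T) : f =ᵐ[volume] f' := by
  rw [← sub_ae_eq_zero]
  refine ae_eq_zero_of_integral_contDiff_smul_eq_zero
    (h.locallyIntegrable.sub h'.locallyIntegrable) fun g hg hgc => ?_
  have hg₁ : HasCompactSupport (Complex.ofRealCLM ∘ g) := hgc.comp_left rfl
  have hg₂ : ContDiff ℝ ∞ (Complex.ofRealCLM ∘ g) := by fun_prop
  set φ := hg₁.toSchwartzMap hg₂ with hφ
  have hφx : ∀ x, φ x = (g x : ℂ) := fun x => rfl
  have := integral_sub (h.integrable φ) (h'.integrable φ)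
  rw [← h.apply_eq, ← h'.apply_eq, sub_self] at this
  rw [← this]
  refine integral_congr_ae (.of_forall fun x => ?_)
  simp only [Pi.sub_apply, hφx, Complex.real_smul]
  ring

theorem toTemperedDistribution {p : ℝ≥0∞} [hp : Fact (1 ≤ p)]
    (u : Lp ℂ p (volume : Measure (EuclideanSpace ℝ (Fin d)))) :
    Represents u (Lp.toTemperedDistribution u) where
  locallyIntegrable := (Lp.memLp u).locallyIntegrable hp.out
  integrable φ := by
    have := ENNReal.HolderConjugate.inv_one_sub_inv' hp.out
    exact (Lp.memLp u).integrable_mul (φ.memLp (1 - p⁻¹)⁻¹) |>.congr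
      (.of_forall fun x => by simp [mul_comm])
  apply_eq φ := by simp

theorem add (h : Represents f T) (h' : Represents f' T') :
    Represents (fun x => f x + f' x) (T + T') where
  locallyIntegrable := h.locallyIntegrable.add h'.locallyIntegrable
  integrable φ := by
    simpa only [mul_add] using! (h.integrable φ).add (h'.integrable φ)
  apply_eq φ := by
    simp only [mul_add]
    rw [integral_add (h.integrable φ) (h'.integrable φ), ← h.apply_eq, ← h'.apply_eq]
    rfl

theorem zero : Represents (fun _ => 0) (0 : 𝓢'(EuclideanSpace ℝ (Fin d), ℂ)) where
  locallyIntegrable := locallyIntegrable_const 0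
  integrable φ := by simp
  apply_eq φ := by simp

theorem const_smul (c : ℂ) (h : Represents f T) : Represents (fun x => c * f x) (c • T) where
  locallyIntegrable := h.locallyIntegrable.smul c
  integrable φ := by
    simpa only [mul_left_comm] using (h.integrable φ).const_mul c
  apply_eq φ := by
    simp only [mul_left_comm]
    rw [integral_const_mul, ← h.apply_eq]
    rfl

theorem sum {ι : Type*} (s : Finset ι) {f : ι → EuclideanSpace ℝ (Fin d) → ℂ}
    {T : ι → 𝓢'(EuclideanSpace ℝ (Fin d), ℂ)} (h : ∀ i ∈ s, Represents (f i) (T i)) :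
    Represents (fun x => ∑ i ∈ s, f i x) (∑ i ∈ s, T i) := by
  classical
  induction s using Finset.induction_on with
  | empty => simpa using zero
  | insert a s ha ih =>
    simp only [Finset.sum_insert ha]
    exact (h a (by simp)).add (ih fun i hi => h i (by simp [hi]))

theorem smulLeftCLM {g : EuclideanSpace ℝ (Fin d) → ℂ} (hg : g.HasTemperateGrowth)
    (h : Represents f T) :
    Represents (fun x => g x * f x) (TemperedDistribution.smulLeftCLM ℂ g T) where
  locallyIntegrable := by
    have := h.locallyIntegrable.locallyIntegrableOn Set.univ
    rw [← locallyIntegrableOn_univ]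
    exact this.continuousOn_mul hg.1.continuous.continuousOn isClosed_univ.isLocallyClosed
  integrable φ := (h.integrable (SchwartzMap.smulLeftCLM ℂ g φ)).congr
    (.of_forall fun x => by simp [SchwartzMap.smulLeftCLM_apply_apply hg]; ring)
  apply_eq φ := by
    rw [TemperedDistribution.smulLeftCLM_apply_apply, h.apply_eq]
    refine integral_congr_ae (.of_forall fun x => ?_)
    simp only [SchwartzMap.smulLeftCLM_apply_apply hg, smul_eq_mul]
    ring

end Represents

/-! ### Square integrable distributions -/

/-- The tempered distributions given by `L²` functions. -/
noncomputable def squareIntegrable (d : ℕ) : Submodule ℂ 𝓢'(EuclideanSpace ℝ (Fin d), ℂ) :=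
  LinearMap.range (Lp.toTemperedDistributionCLM ℂ
    (volume : Measure (EuclideanSpace ℝ (Fin d))) 2).toLinearMap

section
variable {d : ℕ} {f : EuclideanSpace ℝ (Fin d) → ℂ} {T : 𝓢'(EuclideanSpace ℝ (Fin d), ℂ)}

theorem toTemperedDistribution_mem (u : L2Space d) :
    Lp.toTemperedDistribution u ∈ squareIntegrable d := ⟨u, rfl⟩

theorem toTemperedDistribution_injective {u v : L2Space d}
    (h : (Lp.toTemperedDistribution u) = Lp.toTemperedDistribution v) : u = v :=
  Lp.ext (((Represents.toTemperedDistribution u).ae_eq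
    (h ▸ Represents.toTemperedDistribution v)))

theorem Represents.eq_toTemperedDistribution (h : Represents f T) (hf : MemLp f 2) :
    T = Lp.toTemperedDistribution (hf.toLp f) := by
  ext φ
  rw [h.apply_eq, Lp.toTemperedDistribution_apply]
  exact integral_congr_ae (hf.coeFn_toLp.mono fun x hx => by simp [hx])

theorem Represents.mem_squareIntegrable (h : Represents f T) (hf : MemLp f 2) :
    T ∈ squareIntegrable d :=
  ⟨hf.toLp f, (h.eq_toTemperedDistribution hf).symm⟩

theorem memLp_bounded_mul {g : EuclideanSpace ℝ (Fin d) → ℂ} (hg : Continuous g) {C : ℝ}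
    (hC : ∀ x, ‖g x‖ ≤ C) (hf : MemLp f 2) : MemLp (fun x => g x * f x) 2 :=
  hf.of_le_mul (c := C) (hg.aestronglyMeasurable.mul hf.1) (.of_forall fun x => by
    rw [norm_mul]; gcongr; exact hC x)

theorem smulLeftCLM_mem_squareIntegrable {g : EuclideanSpace ℝ (Fin d) → ℂ}
    (hg : g.HasTemperateGrowth) {C : ℝ} (hC : ∀ x, ‖g x‖ ≤ C) (hT : T ∈ squareIntegrable d) :
    TemperedDistribution.smulLeftCLM ℂ g T ∈ squareIntegrable d := by
  obtain ⟨u, rfl⟩ := hT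
  exact ((Represents.toTemperedDistribution u).smulLeftCLM hg).mem_squareIntegrable
    (memLp_bounded_mul hg.1.continuous hC (Lp.memLp u))

/-- The complex conjugate of a Schwartz function. -/
noncomputable def conjSchwartz (φ : 𝓢(EuclideanSpace ℝ (Fin d), ℂ)) :
    𝓢(EuclideanSpace ℝ (Fin d), ℂ) :=
  φ.postcompCLM (Complex.conjCLE : ℂ →L[ℝ] ℂ)

theorem conjSchwartz_apply (φ : 𝓢(EuclideanSpace ℝ (Fin d), ℂ)) (x : EuclideanSpace ℝ (Fin d)) :
    conjSchwartz φ x = starRingEnd ℂ (φ x) := rfl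

theorem conjSchwartz_conjSchwartz (φ : 𝓢(EuclideanSpace ℝ (Fin d), ℂ)) :
    conjSchwartz (conjSchwartz φ) = φ := by
  ext x
  simp [conjSchwartz_apply]

/-- The pairing of distributions with test functions is bilinear, the inner product is antilinear in
the first variable; this conjugation links the two. -/
theorem inner_toLp_eq (φ : 𝓢(EuclideanSpace ℝ (Fin d), ℂ)) (u : L2Space d) :
    inner ℂ (φ.toLp 2) u = Lp.toTemperedDistribution u (conjSchwartz φ) := by
  rw [L2.inner_def, Lp.toTemperedDistribution_apply]
  refine integral_congr_ae ((φ.coeFn_toLp 2 volume).mono fun x hx => ?_)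
  simp only [hx, conjSchwartz_apply, RCLike.inner_apply, smul_eq_mul, mul_comm]

/-- A tempered distribution that is bounded in the `L²` norm of the test function is given by an
`L²` function. -/
theorem mem_squareIntegrable_of_bound {C : ℝ}
    (h : ∀ φ : 𝓢(EuclideanSpace ℝ (Fin d), ℂ), ‖T φ‖ ≤ C * ‖φ.toLp 2 volume‖) :
    T ∈ squareIntegrable d := by
  have hd : DenseRange (SchwartzMap.toLpCLM ℂ ℂ 2
      (volume : Measure (EuclideanSpace ℝ (Fin d)))).toLinearMap :=
    denseRange_toLpCLM (p := 2) (by simp)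
  set ℓ : L2Space d →L[ℂ] ℂ := LinearMap.extendOfNorm T.toLinearMap
    (SchwartzMap.toLpCLM ℂ ℂ 2 (volume : Measure (EuclideanSpace ℝ (Fin d)))).toLinearMap with hℓ
  have hℓφ : ∀ φ : 𝓢(EuclideanSpace ℝ (Fin d), ℂ), ℓ (φ.toLp 2 volume) = T φ := fun φ =>
    LinearMap.extendOfNorm_eq hd ⟨C, h⟩ φ
  set w := (InnerProductSpace.toDual ℂ (L2Space d)).symm ℓ
  -- The Riesz representative `w` satisfies `ℓ = ⟪w, ·⟫`; the pairing of distributions is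
  -- bilinear, hence the conjugate.
  refine ⟨star w, ?_⟩
  ext φ
  rw [← hℓφ, ← InnerProductSpace.toDual_symm_apply, L2.inner_def]
  change Lp.toTemperedDistribution (star w) φ = _
  rw [Lp.toTemperedDistribution_apply]
  refine integral_congr_ae ?_
  filter_upwards [φ.coeFn_toLp 2 volume, Lp.coeFn_star w] with x h1 h2
  simp [h1, h2, RCLike.inner_apply, w]

end

/-! ### Plancherel and the energy identity -/

section

open FourierTransform Laplacian Complex
open TemperedDistribution (MemSobolev besselPotential memSobolev_zero_iff
  memSobolev_besselPotential_iff)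
open scoped Real

variable {d : ℕ}

theorem laplacian_eq_sum_single (T : 𝓢'(EuclideanSpace ℝ (Fin d), ℂ)) :
    Δ T = ∑ j : Fin d, ∂_{EuclideanSpace.single j (1 : ℝ)}
      (∂_{EuclideanSpace.single j (1 : ℝ)} T) := by
  simpa using TemperedDistribution.laplacian_eq_sum (EuclideanSpace.basisFun (Fin d) ℝ) T

/-- The Fourier transform turns a weak derivative in `L²` into multiplication by `2πi⟨ξ, m⟩`, almost
everywhere. -/
theorem fourier_weakPartial_ae {u w : L2Space d} {m : EuclideanSpace ℝ (Fin d)}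
    (h : ∂_{m} (Lp.toTemperedDistribution u) = Lp.toTemperedDistribution w) :
    ∀ᵐ x, (𝓕 w : L2Space d) x = 2 * π * I * (inner ℝ x m : ℝ) * (𝓕 u : L2Space d) x := by
  have hm : (fun x => ((inner ℝ x m : ℝ) : ℂ)).HasTemperateGrowth := by fun_prop
  have h1 := congrArg (fun T => 𝓕 T) h
  simp only [TemperedDistribution.fourier_lineDerivOp_eq,
    Lp.fourier_toTemperedDistribution_eq] at h1
  have h2 := ((Represents.toTemperedDistribution (𝓕 u : L2Space d)).smulLeftCLM hm).const_smul
    (2 * π * I)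
  rw [h1] at h2
  filter_upwards [h2.ae_eq (Represents.toTemperedDistribution _)] with x hx
  rw [← hx]
  ring

/-- Integration by parts of an `H¹` function against an `L²` vector field with divergence in `L²`,
by Plancherel's theorem. -/
theorem inner_divergence_eq {F K : L2Space d} {F' K' : Fin d → L2Space d}
    (hF : ∀ j, ∂_{EuclideanSpace.single j (1 : ℝ)} (Lp.toTemperedDistribution F) =
      Lp.toTemperedDistribution (F' j))
    (hK : ∑ j, ∂_{EuclideanSpace.single j (1 : ℝ)} (Lp.toTemperedDistribution (K' j)) =
      Lp.toTemperedDistribution K) :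
    inner ℂ F K = -∑ j, inner ℂ (F' j) (K' j) := by
  have hm : ∀ j : Fin d, (fun x : EuclideanSpace ℝ (Fin d) =>
      ((inner ℝ x (EuclideanSpace.single j (1 : ℝ)) : ℝ) : ℂ)).HasTemperateGrowth := by
    intro j; fun_prop
  have h1 := congrArg (fun T => fourierCLM ℂ 𝓢'(EuclideanSpace ℝ (Fin d), ℂ) T) hK
  simp only [map_sum, fourierCLM_apply, TemperedDistribution.fourier_lineDerivOp_eq,
    Lp.fourier_toTemperedDistribution_eq] at h1
  have h2 := Represents.sum Finset.univ fun j _ =>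
    ((Represents.toTemperedDistribution (𝓕 (K' j) : L2Space d)).smulLeftCLM (hm j)).const_smul
      (2 * π * I)
  rw [h1] at h2
  have h3 := h2.ae_eq (Represents.toTemperedDistribution _)
  have h4 : ∀ᵐ x, ∀ j, (𝓕 (F' j) : L2Space d) x =
      2 * π * I * (inner ℝ x (EuclideanSpace.single j (1 : ℝ)) : ℝ) * (𝓕 F : L2Space d) x :=
    ae_all_iff.2 fun j => fourier_weakPartial_ae (hF j)
  rw [← Lp.inner_fourier_eq, L2.inner_def]
  simp_rw [← Lp.inner_fourier_eq (F' _) (K' _), L2.inner_def]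
  rw [← integral_finsetSum _ fun j _ => L2.integrable_inner _ _, ← integral_neg]
  refine integral_congr_ae ?_
  filter_upwards [h3, h4] with x hx hx'
  simp only [RCLike.inner_apply, hx', ← hx, Finset.sum_mul, map_mul, Complex.conj_ofReal,
    Complex.conj_I, map_ofNat, ← Finset.sum_neg_distrib]
  refine Finset.sum_congr rfl fun j _ => ?_
  ring

/-- The Bessel potential of order two is a constant-coefficient differential operator, so membership
in a Sobolev space of an order higher by two can be tested on the Laplacian. -/
theorem besselPotential_two_eq (T : 𝓢'(EuclideanSpace ℝ (Fin d), ℂ)) :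
    besselPotential (EuclideanSpace ℝ (Fin d)) ℂ 2 T = T - ((2 * π) ^ 2 : ℂ)⁻¹ • Δ T := by
  have h1 : (fun x : EuclideanSpace ℝ (Fin d) => ((‖x‖ ^ 2 : ℝ) : ℂ)).HasTemperateGrowth := by
    fun_prop
  have h2 : (fun x : EuclideanSpace ℝ (Fin d) => (((1 + ‖x‖ ^ 2) ^ ((2 : ℝ) / 2) : ℝ) : ℂ)) =
      (fun _ => (1 : ℂ)) + fun x => ((‖x‖ ^ 2 : ℝ) : ℂ) := by
    ext x
    simp
  have h3 : TemperedDistribution.smulLeftCLM ℂ (fun x : EuclideanSpace ℝ (Fin d) =>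
        (((1 + ‖x‖ ^ 2) ^ ((2 : ℝ) / 2) : ℝ) : ℂ)) =
      TemperedDistribution.smulLeftCLM ℂ (fun _ => (1 : ℂ)) +
        TemperedDistribution.smulLeftCLM ℂ fun x => ((‖x‖ ^ 2 : ℝ) : ℂ) := by
    rw [h2, TemperedDistribution.smulLeftCLM_add (by fun_prop) h1]
  have hpi : ((2 * π) ^ 2 : ℂ) ≠ 0 := by simp [Real.pi_ne_zero]
  have h4 : Δ T = -((2 * π) ^ 2 : ℂ) •
      TemperedDistribution.fourierMultiplierCLM ℂ (fun x => ((‖x‖ ^ 2 : ℝ) : ℂ)) T := by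
    rw [TemperedDistribution.laplacian_eq_fourierMultiplierCLM, ← Complex.coe_smul]
    push_cast
    rfl
  rw [h4, smul_smul, mul_neg, inv_mul_cancel₀ hpi, neg_one_smul, sub_neg_eq_add]
  simp only [besselPotential, TemperedDistribution.fourierMultiplierCLM_apply, h3,
    add_apply, fourierInv_add]
  simp

theorem MemSobolev.sum {s : ℝ} {ι : Type*} (t : Finset ι)
    {T : ι → 𝓢'(EuclideanSpace ℝ (Fin d), ℂ)} (h : ∀ i ∈ t, MemSobolev s 2 (T i)) :
    MemSobolev s 2 (∑ i ∈ t, T i) := by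
  classical
  induction t using Finset.induction_on with
  | empty => simp
  | insert a t ha ih =>
    rw [Finset.sum_insert ha]
    exact (h a (by simp)).add (ih fun i hi => h i (by simp [hi]))

theorem memSobolev_zero_of_Lp (u : L2Space d) :
    MemSobolev 0 2 (Lp.toTemperedDistribution u) :=
  memSobolev_zero_iff.2 ⟨u, rfl⟩

/-- Weak solutions of `-½ΔF + W = G + div G'` with all data in `L²` are in `H¹` and satisfy the
energy identity. -/
theorem exists_gradient_energy_eq {F W G : L2Space d} {G' : Fin d → L2Space d}
    (h : -(1 / 2 : ℂ) • Δ (Lp.toTemperedDistribution F) + Lp.toTemperedDistribution W =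
      Lp.toTemperedDistribution G +
        ∑ j, ∂_{EuclideanSpace.single j (1 : ℝ)} (Lp.toTemperedDistribution (G' j))) :
    ∃ F' : Fin d → L2Space d,
      (∀ j, ∂_{EuclideanSpace.single j (1 : ℝ)} (Lp.toTemperedDistribution F) =
        Lp.toTemperedDistribution (F' j)) ∧
      (1 / 2 : ℂ) * ∑ j, inner ℂ (F' j) (F' j) + inner ℂ F W =
        inner ℂ F G - ∑ j, inner ℂ (F' j) (G' j) := by
  have hΔ : Δ (Lp.toTemperedDistribution F) = (2 : ℂ) • (Lp.toTemperedDistribution W -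
      (Lp.toTemperedDistribution G +
        ∑ j, ∂_{EuclideanSpace.single j (1 : ℝ)} (Lp.toTemperedDistribution (G' j)))) := by
    rw [← h]; module
  -- The equation puts `ΔF` in `H⁻¹`, hence `(1 - (2π)⁻²Δ)F` is in `H⁻¹` and `F` is in `H¹`.
  have hS : MemSobolev (-1) 2 (Δ (Lp.toTemperedDistribution F)) := by
    have h0 : ∀ u : L2Space d, MemSobolev (-1) 2 (Lp.toTemperedDistribution u) := fun u =>
      (memSobolev_zero_of_Lp u).mono (by norm_num)
    rw [hΔ]
    refine ((h0 W).sub ((h0 G).add (MemSobolev.sum _ fun j _ => ?_))).smul _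
    simpa using (memSobolev_zero_of_Lp (G' j)).lineDerivOp
  have hF : MemSobolev 1 2 (Lp.toTemperedDistribution F) := by
    have h1 : MemSobolev (-1) 2 (besselPotential _ ℂ 2 (Lp.toTemperedDistribution F)) := by
      rw [besselPotential_two_eq]
      exact ((memSobolev_zero_of_Lp F).mono (by norm_num)).sub (hS.smul _)
    rw [memSobolev_besselPotential_iff] at h1
    convert h1 using 1
    norm_num
  have hD : ∀ j : Fin d, ∃ w : L2Space d,
      ∂_{EuclideanSpace.single j (1 : ℝ)} (Lp.toTemperedDistribution F) =
        Lp.toTemperedDistribution w := fun j => by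
    have := hF.lineDerivOp (m := EuclideanSpace.single j (1 : ℝ))
    rw [sub_self] at this
    exact memSobolev_zero_iff.1 this
  choose F' hF' using hD
  refine ⟨F', hF', ?_⟩
  -- The identity is the integration by parts of `F` against the field `-½∇F - G'`, whose
  -- divergence is `G - W`.
  have hK : ∑ j, ∂_{EuclideanSpace.single j (1 : ℝ)}
      (Lp.toTemperedDistribution ((-(1 / 2 : ℂ)) • F' j + (-1 : ℂ) • G' j)) =
      Lp.toTemperedDistribution (G - W) := by
    simp only [← Lp.toTemperedDistributionCLM_apply, map_sub, map_add, map_smul, lineDerivOp_add,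
      lineDerivOp_smul, Finset.sum_add_distrib, ← Finset.smul_sum] at h hF' ⊢
    simp only [← hF', ← laplacian_eq_sum_single]
    rw [neg_one_smul, ← sub_eq_add_neg, sub_eq_iff_eq_add, sub_add_eq_add_sub, ← h]
    abel
  have := inner_divergence_eq hF' hK
  simp only [inner_sub_right, inner_add_right, inner_smul_right, Finset.sum_add_distrib,
    ← Finset.mul_sum] at this
  linear_combination -this

end

/-! ### Products with cutoff functions -/

section

open Laplacian
open TemperedDistribution (lineDerivOp_smulLeftCLM)

variable {d : ℕ}

theorem exists_Lp_smulLeftCLM {g : EuclideanSpace ℝ (Fin d) → ℂ} (hg : g.HasTemperateGrowth)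
    {C : ℝ} (hC : ∀ x, ‖g x‖ ≤ C) (u : L2Space d) :
    ∃ w : L2Space d, Lp.toTemperedDistribution w =
        TemperedDistribution.smulLeftCLM ℂ g (Lp.toTemperedDistribution u) ∧
      ‖w‖ ≤ C * ‖u‖ ∧ ∀ᵐ x, w x = g x * u x := by
  have h := (Represents.toTemperedDistribution u).smulLeftCLM hg
  have hm := memLp_bounded_mul hg.1.continuous hC (Lp.memLp u)
  refine ⟨hm.toLp _, (h.eq_toTemperedDistribution hm).symm, ?_, hm.coeFn_toLp⟩
  refine Lp.norm_le_mul_norm_of_ae_le_mul (hm.coeFn_toLp.mono fun x hx => ?_)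
  rw [hx, norm_mul]
  gcongr
  exact hC x

theorem norm_toTemperedDistribution_apply_le (u : L2Space d)
    (φ : 𝓢(EuclideanSpace ℝ (Fin d), ℂ)) :
    ‖Lp.toTemperedDistribution u φ‖ ≤ ‖u‖ * ‖φ.toLp 2 volume‖ := by
  have h2 : ‖(conjSchwartz φ).toLp 2 volume‖ = ‖φ.toLp 2 volume‖ := by
    rw [norm_toLp, norm_toLp]
    congr 1
    exact eLpNorm_congr_norm_ae (.of_forall fun x => by simp [conjSchwartz_apply])
  have := norm_inner_le_norm (𝕜 := ℂ) ((conjSchwartz φ).toLp 2 volume) u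
  rwa [inner_toLp_eq, conjSchwartz_conjSchwartz, h2, mul_comm] at this

/-- The Laplacian of a product with a Schwartz function `χ`, with the first-order term in divergence
form: `Δ(χT) = χΔT + 2 ∑_j ∂_j((∂_jχ)T) - (Δχ)T`. No derivative of `T` itself is left besides
`χΔT`. -/
theorem laplacian_smulLeftCLM (χ : 𝓢(EuclideanSpace ℝ (Fin d), ℂ))
    (T : 𝓢'(EuclideanSpace ℝ (Fin d), ℂ)) :
    Δ (TemperedDistribution.smulLeftCLM ℂ χ T) = TemperedDistribution.smulLeftCLM ℂ χ (Δ T) +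
      (2 : ℂ) • ∑ j : Fin d, ∂_{EuclideanSpace.single j (1 : ℝ)}
        (TemperedDistribution.smulLeftCLM ℂ
          (∂_{EuclideanSpace.single j (1 : ℝ)} χ : 𝓢(EuclideanSpace ℝ (Fin d), ℂ)) T) -
      ∑ j : Fin d, TemperedDistribution.smulLeftCLM ℂ (∂_{EuclideanSpace.single j (1 : ℝ)}
        (∂_{EuclideanSpace.single j (1 : ℝ)} χ) : 𝓢(EuclideanSpace ℝ (Fin d), ℂ)) T := by
  have hp : ∀ (ψ : 𝓢(EuclideanSpace ℝ (Fin d), ℂ)) (m : EuclideanSpace ℝ (Fin d))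
      (S : 𝓢'(EuclideanSpace ℝ (Fin d), ℂ)),
      ∂_{m} (TemperedDistribution.smulLeftCLM ℂ ψ S) =
        TemperedDistribution.smulLeftCLM ℂ ψ (∂_{m} S) +
          TemperedDistribution.smulLeftCLM ℂ
            (∂_{m} ψ : 𝓢(EuclideanSpace ℝ (Fin d), ℂ)) S := fun ψ m S =>
    lineDerivOp_smulLeftCLM ψ.hasTemperateGrowth m
      (∂_{m} ψ : 𝓢(EuclideanSpace ℝ (Fin d), ℂ)).hasTemperateGrowth S
  simp only [laplacian_eq_sum_single, map_sum, hp, lineDerivOp_add, Finset.smul_sum,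
    ← Finset.sum_add_distrib, ← Finset.sum_sub_distrib]
  refine Finset.sum_congr rfl fun j _ => ?_
  module

/-- A sequence of cutoff functions with uniformly bounded derivatives exhausting the space. -/
theorem exists_cutoff_sequence (d : ℕ) :
    ∃ (A : ℝ) (χ : ℕ → 𝓢(EuclideanSpace ℝ (Fin d), ℂ)), (∀ n x, ‖χ n x‖ ≤ 1) ∧
      (∀ n (j : Fin d) x, ‖(∂_{EuclideanSpace.single j (1 : ℝ)} (χ n)) x‖ ≤ A) ∧
      (∀ n (j : Fin d) x, ‖(∂_{EuclideanSpace.single j (1 : ℝ)}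
        (∂_{EuclideanSpace.single j (1 : ℝ)} (χ n))) x‖ ≤ A) ∧
      ∀ x, Filter.Tendsto (fun n => χ n x) Filter.atTop (nhds 1) := by
  let b : ContDiffBump (0 : EuclideanSpace ℝ (Fin d)) := ⟨1, 2, by norm_num, by norm_num⟩
  have hb₁ : HasCompactSupport (Complex.ofRealCLM ∘ b) := b.hasCompactSupport.comp_left rfl
  have hb₂ : ContDiff ℝ ∞ (Complex.ofRealCLM ∘ b) := by
    exact Complex.ofRealCLM.contDiff.comp b.contDiff
  let ψ := hb₁.toSchwartzMap hb₂
  have hψ : ∀ x, ψ x = (b x : ℂ) := fun x => rfl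
  have hc : ∀ n : ℕ, ((n : ℝ) + 1)⁻¹ ≠ 0 := fun n => by positivity
  -- The cutoffs are the rescaled bumps `χ_n(x) = ψ(x / (n + 1))`; each derivative gains a factor
  -- `(n + 1)⁻¹ ≤ 1`.
  let g : ℕ → EuclideanSpace ℝ (Fin d) ≃L[ℝ] EuclideanSpace ℝ (Fin d) := fun n =>
    (LinearEquiv.smulOfNeZero ℝ _ _ (hc n)).toContinuousLinearEquiv
  have hg : ∀ n x, g n x = ((n : ℝ) + 1)⁻¹ • x := fun n x => rfl
  let χ : ℕ → 𝓢(EuclideanSpace ℝ (Fin d), ℂ) := fun n => compCLMOfContinuousLinearEquiv ℂ (g n) ψ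
  have hχ' : ∀ n (m : EuclideanSpace ℝ (Fin d)) (η : 𝓢(EuclideanSpace ℝ (Fin d), ℂ)),
      ∂_{m} (compCLMOfContinuousLinearEquiv ℂ (g n) η) =
        ((n : ℝ) + 1)⁻¹ • compCLMOfContinuousLinearEquiv ℂ (g n) (∂_{m} η) := fun n m η => by
    rw [lineDerivOp_compCLMOfContinuousLinearEquiv, hg, lineDerivOp_left_smul]
    ext x
    simp
  have hc1 : ∀ n : ℕ, ‖((n : ℝ) + 1)⁻¹‖ ≤ 1 := fun n => by
    rw [norm_inv, Real.norm_of_nonneg (by positivity)]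
    exact inv_le_one_of_one_le₀ (by simp)
  let A : Fin d → ℝ := fun j => SchwartzMap.seminorm ℝ 0 0 (∂_{EuclideanSpace.single j (1 : ℝ)} ψ)
  let B : Fin d → ℝ := fun j => SchwartzMap.seminorm ℝ 0 0 (∂_{EuclideanSpace.single j (1 : ℝ)}
    (∂_{EuclideanSpace.single j (1 : ℝ)} ψ))
  have hA : ∀ j, A j ≤ ∑ i, (A i + B i) := fun j =>
    (le_add_of_nonneg_right (apply_nonneg _ _)).trans (Finset.single_le_sum
      (f := fun i => A i + B i) (fun i _ => add_nonneg (apply_nonneg _ _) (apply_nonneg _ _))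
      (Finset.mem_univ j))
  have hB : ∀ j, B j ≤ ∑ i, (A i + B i) := fun j =>
    (le_add_of_nonneg_left (apply_nonneg _ _)).trans (Finset.single_le_sum
      (f := fun i => A i + B i) (fun i _ => add_nonneg (apply_nonneg _ _) (apply_nonneg _ _))
      (Finset.mem_univ j))
  refine ⟨∑ i, (A i + B i), χ,
    fun n x => ?_, fun n j x => ?_, fun n j x => ?_, fun x => ?_⟩
  · change ‖ψ (g n x)‖ ≤ 1
    rw [hψ, Complex.norm_real, Real.norm_of_nonneg b.nonneg]
    exact b.le_one
  · simp only [χ, hχ', smul_apply, norm_smul]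
    refine (mul_le_of_le_one_left (norm_nonneg _) (hc1 n)).trans ?_
    exact (norm_le_seminorm ℝ (∂_{EuclideanSpace.single j (1 : ℝ)} ψ) (g n x)).trans (hA j)
  · simp only [χ, hχ', lineDerivOp_smul, smul_apply, norm_smul]
    refine (mul_le_of_le_one_left (by positivity) (hc1 n)).trans
      ((mul_le_of_le_one_left (norm_nonneg _) (hc1 n)).trans ?_)
    exact (norm_le_seminorm ℝ (∂_{EuclideanSpace.single j (1 : ℝ)}
      (∂_{EuclideanSpace.single j (1 : ℝ)} ψ)) (g n x)).trans (hB j)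
  · have h0 : ψ 0 = 1 := by
      rw [hψ, b.one_of_mem_closedBall (by simp [b])]
      simp
    have h1 : Filter.Tendsto (fun n : ℕ => ((n : ℝ) + 1)⁻¹ • x) Filter.atTop (nhds 0) := by
      have : Filter.Tendsto (fun n : ℕ => ((n : ℝ) + 1)⁻¹) Filter.atTop (nhds 0) := by
        simpa using tendsto_one_div_add_atTop_nhds_zero_nat (𝕜 := ℝ)
      simpa using this.smul_const x
    rw [← h0]
    exact (ψ.continuous.tendsto 0).comp h1

end

/-! ### The energy estimate -/

section

open Laplacian

variable {d : ℕ}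

theorem coord_hasTemperateGrowth (j : Fin d) : (fun x : EuclideanSpace ℝ (Fin d) =>
    ((inner ℝ x (EuclideanSpace.single j (1 : ℝ)) : ℝ) : ℂ)).HasTemperateGrowth := by
  fun_prop

/-- Multiplying an `L²` function by a Schwartz function and a function of temperate growth yields an
`L²` function. -/
theorem exists_Lp_smulLeftCLM_smulLeftCLM {g : EuclideanSpace ℝ (Fin d) → ℂ}
    (hg : g.HasTemperateGrowth) (χ : 𝓢(EuclideanSpace ℝ (Fin d), ℂ)) (f : L2Space d) :
    ∃ w : L2Space d, Lp.toTemperedDistribution w = TemperedDistribution.smulLeftCLM ℂ g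
        (TemperedDistribution.smulLeftCLM ℂ χ (Lp.toTemperedDistribution f)) ∧
      ∀ᵐ x, w x = g x * (χ x * f x) := by
  obtain ⟨w, hw, -, hw'⟩ := exists_Lp_smulLeftCLM
    (SchwartzMap.smulLeftCLM ℂ g χ).hasTemperateGrowth (norm_le_seminorm ℝ _) f
  refine ⟨w, ?_, hw'.mono fun x hx => ?_⟩
  · rw [hw, TemperedDistribution.smulLeftCLM_smulLeftCLM_apply χ.hasTemperateGrowth hg,
      SchwartzMap.smulLeftCLM_apply hg]
    congr 2
    ext x
    simp [mul_comm]
  · rw [hx, SchwartzMap.smulLeftCLM_apply_apply hg, smul_eq_mul, mul_assoc]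

/-- The energy of `χ f`, for a weak solution `f` of `-½Δf + Vf = g` and a cutoff function `χ`, is
bounded in terms of the sizes of `f`, `g` and the derivatives of `χ` only. -/
theorem energy_cutoff_le {V : EuclideanSpace ℝ (Fin d) → ℝ}
    (hV : (fun x => (V x : ℂ)).HasTemperateGrowth) {δ : ℝ} (hδ : 0 < δ)
    (hVδ : ∀ x, δ * ‖x‖ ^ 2 ≤ V x) {f g : L2Space d}
    (h : -(1 / 2 : ℂ) • Δ (Lp.toTemperedDistribution f) +
      TemperedDistribution.smulLeftCLM ℂ (fun x => (V x : ℂ)) (Lp.toTemperedDistribution f) =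
        Lp.toTemperedDistribution g)
    {A : ℝ} {χ : 𝓢(EuclideanSpace ℝ (Fin d), ℂ)} (hχ : ∀ x, ‖χ x‖ ≤ 1)
    (hχ' : ∀ (j : Fin d) x, ‖(∂_{EuclideanSpace.single j (1 : ℝ)} χ) x‖ ≤ A)
    (hχ'' : ∀ (j : Fin d) x, ‖(∂_{EuclideanSpace.single j (1 : ℝ)}
      (∂_{EuclideanSpace.single j (1 : ℝ)} χ)) x‖ ≤ A) :
    ∃ F' w : Fin d → L2Space d,
      (∀ j, ∂_{EuclideanSpace.single j (1 : ℝ)} (TemperedDistribution.smulLeftCLM ℂ χ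
        (Lp.toTemperedDistribution f)) = Lp.toTemperedDistribution (F' j)) ∧
      (∀ j, TemperedDistribution.smulLeftCLM ℂ
        (fun x => ((inner ℝ x (EuclideanSpace.single j (1 : ℝ)) : ℝ) : ℂ))
        (TemperedDistribution.smulLeftCLM ℂ χ (Lp.toTemperedDistribution f)) =
          Lp.toTemperedDistribution (w j)) ∧
      (∀ j, 1 / 4 * ‖F' j‖ ^ 2 ≤ ‖f‖ * (‖g‖ + d * A * ‖f‖) + d * (A * ‖f‖) ^ 2) ∧
      ∀ j, δ * ‖w j‖ ^ 2 ≤ ‖f‖ * (‖g‖ + d * A * ‖f‖) + d * (A * ‖f‖) ^ 2 := by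
  obtain ⟨F, hF, hFn, hFx⟩ := exists_Lp_smulLeftCLM χ.hasTemperateGrowth hχ f
  obtain ⟨χg, hχg, hχgn, -⟩ := exists_Lp_smulLeftCLM χ.hasTemperateGrowth hχ g
  obtain ⟨W, hW, hWx⟩ := exists_Lp_smulLeftCLM_smulLeftCLM hV χ f
  choose w hw hwx using fun j : Fin d =>
    exists_Lp_smulLeftCLM_smulLeftCLM (coord_hasTemperateGrowth j) χ f
  choose P hP hPn _ using fun j : Fin d => exists_Lp_smulLeftCLM
    (∂_{EuclideanSpace.single j (1 : ℝ)} χ :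
      𝓢(EuclideanSpace ℝ (Fin d), ℂ)).hasTemperateGrowth (hχ' j) f
  choose Q hQ hQn _ using fun j : Fin d => exists_Lp_smulLeftCLM
    (∂_{EuclideanSpace.single j (1 : ℝ)} (∂_{EuclideanSpace.single j (1 : ℝ)} χ) :
      𝓢(EuclideanSpace ℝ (Fin d), ℂ)).hasTemperateGrowth (hχ'' j) f
  -- `χf` solves `-½Δ(χf) + Vχf = χg + ½(Δχ)f - ∑_j ∂_j((∂_jχ)f)`, with all data in `L²`.
  have heq : -(1 / 2 : ℂ) • Δ (Lp.toTemperedDistribution F) + Lp.toTemperedDistribution W =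
      Lp.toTemperedDistribution (χg + (1 / 2 : ℂ) • ∑ j, Q j) +
        ∑ j, ∂_{EuclideanSpace.single j (1 : ℝ)}
          (Lp.toTemperedDistribution ((-1 : ℂ) • P j)) := by
    simp only [← Lp.toTemperedDistributionCLM_apply, map_add, map_smul, map_sum, lineDerivOp_smul]
      at h hF hχg hW hP hQ ⊢
    simp only [hF, hχg, hW, hP, hQ, laplacian_smulLeftCLM, ← h, map_add, map_smul,
      ← Finset.smul_sum]
    rw [TemperedDistribution.smulLeftCLM_smulLeftCLM_apply χ.hasTemperateGrowth hV,
      TemperedDistribution.smulLeftCLM_smulLeftCLM_apply hV χ.hasTemperateGrowth, mul_comm]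
    module
  obtain ⟨F', hF', hE⟩ := exists_gradient_energy_eq heq
  have hr := congrArg Complex.re hE
  have hself : ∀ u : L2Space d, (inner ℂ u u).re = ‖u‖ ^ 2 := fun u => by
    rw [inner_self_eq_norm_sq_to_K]; norm_cast
  have hpt : ∀ᵐ x, (inner ℂ (F x) (W x)).re = V x * ‖χ x * f x‖ ^ 2 := by
    filter_upwards [hFx, hWx] with x h1 h2
    rw [h1, h2, RCLike.inner_apply, mul_assoc, RCLike.mul_conj]
    norm_cast
    rw [Complex.re_ofReal_mul]
    rfl
  -- The potential term of the energy is `∫ V |χf|²`, which dominates `δ ∫ |x_jχf|²` by coercivity.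
  have hFW : (inner ℂ F W).re = ∫ x, (inner ℂ (F x) (W x)).re := by
    rw [L2.inner_def]
    exact (integral_re (L2.integrable_inner (𝕜 := ℂ) F W)).symm
  have hW0 : ∀ j, δ * ‖w j‖ ^ 2 ≤ (inner ℂ F W).re := fun j => by
    have e2 : ‖w j‖ ^ 2 = ∫ x, (inner ℂ (w j x) (w j x)).re := by
      rw [← hself, L2.inner_def]
      exact (integral_re (L2.integrable_inner (𝕜 := ℂ) (w j) (w j))).symm
    rw [hFW, e2, ← integral_const_mul]
    refine integral_mono_ae ((L2.integrable_inner (𝕜 := ℂ) (w j) (w j)).re.const_mul δ)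
      (L2.integrable_inner (𝕜 := ℂ) F W).re ?_
    filter_upwards [hpt, hwx j] with x h1 h3
    have e4 : (inner ℂ (w j x) (w j x)).re =
        (inner ℝ x (EuclideanSpace.single j (1 : ℝ))) ^ 2 * ‖χ x * f x‖ ^ 2 := by
      have : (inner ℂ (w j x) (w j x)).re = ‖w j x‖ ^ 2 := by
        rw [inner_self_eq_norm_sq_to_K]; norm_cast
      rw [this, h3, norm_mul, mul_pow, Complex.norm_real, Real.norm_eq_abs, sq_abs]
    rw [h1, e4, ← mul_assoc]
    refine mul_le_mul_of_nonneg_right (le_trans ?_ (hVδ x)) (by positivity)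
    have := abs_real_inner_le_norm x (EuclideanSpace.single j (1 : ℝ))
    rw [PiLp.norm_single, norm_one, mul_one] at this
    gcongr δ * ?_
    exact sq_le_sq.2 (by rwa [abs_norm])
  have hWnn : 0 ≤ (inner ℂ F W).re := by
    rw [hFW]
    refine integral_nonneg_of_ae (hpt.mono fun x hx => ?_)
    simp only [hx, Pi.zero_apply]
    exact mul_nonneg (le_trans (by positivity) (hVδ x)) (by positivity)
  have hFn' : ‖F‖ ≤ ‖f‖ := by simpa using hFn
  have hR1 : (inner ℂ F (χg + (1 / 2 : ℂ) • ∑ j, Q j)).re ≤ ‖f‖ * (‖g‖ + d * A * ‖f‖) := by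
    refine (Complex.re_le_norm _).trans ((norm_inner_le_norm _ _).trans ?_)
    gcongr
    refine (norm_add_le _ _).trans (add_le_add (by simpa using hχgn) ?_)
    rw [norm_smul]
    refine (mul_le_of_le_one_left (norm_nonneg _) (by norm_num)).trans ?_
    refine (norm_sum_le_of_le _ fun j _ => hQn j).trans ?_
    simp [mul_assoc]
  -- Part of the gradient term is absorbed through `ab ≤ a²/4 + b²`.
  have hR2 : -(∑ j, inner ℂ (F' j) ((-1 : ℂ) • P j)).re ≤
      ∑ j, (1 / 4 * ‖F' j‖ ^ 2) + d * (A * ‖f‖) ^ 2 := by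
    have hc : (d : ℝ) * (A * ‖f‖) ^ 2 = ∑ _j : Fin d, (A * ‖f‖) ^ 2 := by simp
    rw [hc, ← Finset.sum_add_distrib, Complex.re_sum, ← Finset.sum_neg_distrib]
    refine Finset.sum_le_sum fun j _ => ?_
    rw [inner_smul_right, neg_one_mul, Complex.neg_re, neg_neg]
    have h1 := (Complex.re_le_norm _).trans (norm_inner_le_norm (𝕜 := ℂ) (F' j) (P j))
    have h2 : ‖F' j‖ * ‖P j‖ ≤ ‖F' j‖ * (A * ‖f‖) := by gcongr; exact hPn j
    nlinarith [sq_nonneg (1 / 2 * ‖F' j‖ - A * ‖f‖)]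
  have hsum : (∑ j, inner ℂ (F' j) (F' j)).re = ∑ j, ‖F' j‖ ^ 2 := by
    simp only [Complex.re_sum, hself]
  have hL : ((1 / 2 : ℂ) * ∑ j, inner ℂ (F' j) (F' j)).re = 1 / 2 * ∑ j, ‖F' j‖ ^ 2 := by
    rw [← hsum]
    simp [Complex.mul_re]
  rw [Complex.add_re, Complex.sub_re, hL] at hr
  rw [← Finset.mul_sum] at hR2
  have hmain : 1 / 4 * ∑ j, ‖F' j‖ ^ 2 + (inner ℂ F W).re ≤
      ‖f‖ * (‖g‖ + d * A * ‖f‖) + d * (A * ‖f‖) ^ 2 := by linarith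
  have hnn : 0 ≤ ∑ j, ‖F' j‖ ^ 2 := Finset.sum_nonneg fun j _ => by positivity
  refine ⟨F', w, fun j => hF ▸ hF' j, fun j => (hw j).symm, fun j => ?_, fun j => ?_⟩
  · have := Finset.single_le_sum (f := fun j => ‖F' j‖ ^ 2) (fun i _ => by positivity)
      (Finset.mem_univ j)
    linarith
  · linarith [hW0 j]

/-- Multiplication by an exhausting sequence of cutoff functions converges weakly to the
identity. -/
theorem tendsto_smulLeftCLM_apply {χ : ℕ → 𝓢(EuclideanSpace ℝ (Fin d), ℂ)}
    (hχ : ∀ n x, ‖χ n x‖ ≤ 1)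
    (hlim : ∀ x, Filter.Tendsto (fun n => χ n x) Filter.atTop (nhds 1)) (f : L2Space d)
    (φ : 𝓢(EuclideanSpace ℝ (Fin d), ℂ)) :
    Filter.Tendsto (fun n => TemperedDistribution.smulLeftCLM ℂ (χ n)
      (Lp.toTemperedDistribution f) φ) Filter.atTop (nhds (Lp.toTemperedDistribution f φ)) := by
  have hr := Represents.toTemperedDistribution f
  have e : ∀ n, TemperedDistribution.smulLeftCLM ℂ (χ n) (Lp.toTemperedDistribution f) φ =
      ∫ x, φ x * (χ n x * f x) := fun n => (hr.smulLeftCLM (χ n).hasTemperateGrowth).apply_eq φ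
  simp only [e, hr.apply_eq φ]
  refine tendsto_integral_of_dominated_convergence (fun x => ‖φ x * f x‖)
    (fun n => ((hr.smulLeftCLM (χ n).hasTemperateGrowth).integrable φ).1)
    (hr.integrable φ).norm (fun n => .of_forall fun x => ?_) (.of_forall fun x => ?_)
  · rw [mul_left_comm, norm_mul]
    exact mul_le_of_le_one_left (norm_nonneg _) (hχ n x)
  · simpa using ((hlim x).mul_const (f x)).const_mul (φ x)

/-- If `f` and `-½Δf + Vf` (in the sense of distributions) are in `L²`, then the first derivatives
of `f` and its products with the coordinates are in `L²`. -/
theorem gradient_coord_mem_squareIntegrable {V : EuclideanSpace ℝ (Fin d) → ℝ}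
    (hV : (fun x => (V x : ℂ)).HasTemperateGrowth) {δ : ℝ} (hδ : 0 < δ)
    (hVδ : ∀ x, δ * ‖x‖ ^ 2 ≤ V x) {T : 𝓢'(EuclideanSpace ℝ (Fin d), ℂ)}
    (hT : T ∈ squareIntegrable d)
    (hHT : -(1 / 2 : ℂ) • Δ T + TemperedDistribution.smulLeftCLM ℂ (fun x => (V x : ℂ)) T ∈
      squareIntegrable d) (j : Fin d) :
    ∂_{EuclideanSpace.single j (1 : ℝ)} T ∈ squareIntegrable d ∧
      TemperedDistribution.smulLeftCLM ℂ
        (fun x => ((inner ℝ x (EuclideanSpace.single j (1 : ℝ)) : ℝ) : ℂ)) T ∈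
          squareIntegrable d := by
  obtain ⟨f, rfl⟩ := hT
  obtain ⟨g, hg⟩ := hHT
  obtain ⟨A, χ, hχ, hχ', hχ'', hlim⟩ := exists_cutoff_sequence d
  choose F' w hF' hw hF'n hwn using fun n =>
    energy_cutoff_le hV hδ hVδ hg.symm (hχ n) (hχ' n) (hχ'' n)
  have hlim' := tendsto_smulLeftCLM_apply hχ hlim f
  set M := ‖f‖ * (‖g‖ + d * A * ‖f‖) + d * (A * ‖f‖) ^ 2
  -- The bounds on `∂_j(χ_n f)` and `x_jχ_n f` are uniform in `n`; they pass to the weak limit,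
  -- where the Riesz criterion applies.
  constructor
  · refine mem_squareIntegrable_of_bound (C := √(4 * M)) fun φ => ?_
    refine le_of_tendsto (hlim' (-∂_{EuclideanSpace.single j (1 : ℝ)} φ)).norm
      (.of_forall fun n => ?_)
    have := congrArg (fun S : 𝓢'(EuclideanSpace ℝ (Fin d), ℂ) => S φ) (hF' n j)
    simp only [TemperedDistribution.lineDerivOp_apply_apply] at this
    rw [this]
    refine (norm_toTemperedDistribution_apply_le _ _).trans ?_
    gcongr
    exact Real.le_sqrt_of_sq_le (by linarith [hF'n n j])
  · refine mem_squareIntegrable_of_bound (C := √(M / δ)) fun φ => ?_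
    refine le_of_tendsto (hlim' (SchwartzMap.smulLeftCLM ℂ
      (fun x => ((inner ℝ x (EuclideanSpace.single j (1 : ℝ)) : ℝ) : ℂ)) φ)).norm
      (.of_forall fun n => ?_)
    have := congrArg (fun S : 𝓢'(EuclideanSpace ℝ (Fin d), ℂ) => S φ) (hw n j)
    rw [TemperedDistribution.smulLeftCLM_apply_apply] at this
    rw [this]
    refine (norm_toTemperedDistribution_apply_le _ _).trans ?_
    gcongr
    refine Real.le_sqrt_of_sq_le ?_
    rw [le_div_iff₀ hδ]
    linarith [hwn n j]

end

/-! ### Functions with bounded derivatives of high order -/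

/-- The function `m` is smooth and all its derivatives of order at least `n` are bounded. -/
structure HasBoundedDerivFrom {E F : Type*} [NormedAddCommGroup E] [NormedSpace ℝ E]
    [NormedAddCommGroup F] [NormedSpace ℝ F] (n : ℕ) (m : E → F) : Prop where
  contDiff : ContDiff ℝ ∞ m
  bounded : ∀ k, n ≤ k → ∃ C : ℝ, ∀ x, ‖iteratedFDeriv ℝ k m x‖ ≤ C

namespace HasBoundedDerivFrom

universe u

variable {E F G : Type u} [NormedAddCommGroup E] [NormedSpace ℝ E]
    [NormedAddCommGroup F] [NormedSpace ℝ F] [NormedAddCommGroup G] [NormedSpace ℝ G]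
    {n : ℕ} {m : E → F}

theorem fderiv (h : HasBoundedDerivFrom (n + 1) m) :
    HasBoundedDerivFrom n (fderiv ℝ m) where
  contDiff := h.contDiff.fderiv_right (by simp)
  bounded k hk := by
    simpa only [norm_iteratedFDeriv_fderiv] using h.bounded (k + 1) (by lia)

theorem clm_comp (h : HasBoundedDerivFrom n m) (L : F →L[ℝ] G) :
    HasBoundedDerivFrom n (fun x => L (m x)) where
  contDiff := L.contDiff.comp h.contDiff
  bounded k hk := by
    obtain ⟨C, hC⟩ := h.bounded k hk
    refine ⟨‖L‖ * C, fun x => ?_⟩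
    refine (L.norm_iteratedFDeriv_comp_left h.contDiff.contDiffAt
      (by exact_mod_cast le_top)).trans ?_
    gcongr
    exact hC x

theorem fderiv_apply (h : HasBoundedDerivFrom (n + 1) m) (v : E) :
    HasBoundedDerivFrom n (fun x => _root_.fderiv ℝ m x v) :=
  h.fderiv.clm_comp (ContinuousLinearMap.apply ℝ F v)

theorem succ (h : HasBoundedDerivFrom n m) : HasBoundedDerivFrom (n + 1) m :=
  ⟨h.contDiff, fun k hk => h.bounded k (by lia)⟩

/-- Boundedness of the derivatives from order `n` on implies polynomial growth of degree `n`, by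
integrating along segments. -/
theorem exists_norm_le (h : HasBoundedDerivFrom n m) :
    ∃ C : ℝ, 0 ≤ C ∧ ∀ x, ‖m x‖ ≤ C * (1 + ‖x‖) ^ n := by
  induction n generalizing F with
  | zero =>
    obtain ⟨C, hC⟩ := h.bounded 0 le_rfl
    refine ⟨C, (norm_nonneg _).trans (hC 0), fun x => ?_⟩
    simpa using hC x
  | succ n ih =>
    obtain ⟨C, hC0, hC⟩ := ih h.fderiv
    refine ⟨‖m 0‖ + C, by positivity, fun x => ?_⟩
    have h1 : ‖m x - m 0‖ ≤ C * (1 + ‖x‖) ^ n * ‖x - 0‖ := by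
      refine (convex_closedBall (0 : E) ‖x‖).norm_image_sub_le_of_norm_fderiv_le
        (fun y _ => (h.contDiff.differentiable (by simp)).differentiableAt) (fun y hy => ?_)
        (by simp) (by simp)
      refine (hC y).trans ?_
      gcongr
      simpa using hy
    have h2 : ‖m x‖ ≤ ‖m 0‖ + ‖m x - m 0‖ := by
      simpa using norm_add_le (m 0) (m x - m 0)
    rw [sub_zero] at h1
    have h3 : (1 : ℝ) ≤ (1 + ‖x‖) ^ (n + 1) := one_le_pow₀ (by simp)
    calc ‖m x‖ ≤ ‖m 0‖ * 1 + C * (1 + ‖x‖) ^ n * ‖x‖ := by linarith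
      _ ≤ ‖m 0‖ * (1 + ‖x‖) ^ (n + 1) + C * (1 + ‖x‖) ^ n * (1 + ‖x‖) := by
        gcongr
        simp
      _ = _ := by ring

theorem hasTemperateGrowth (h : HasBoundedDerivFrom n m) : m.HasTemperateGrowth := by
  induction n generalizing F with
  | zero =>
    refine ⟨h.contDiff, fun k => ?_⟩
    obtain ⟨C, hC⟩ := h.bounded k (by simp)
    exact ⟨0, C, fun x => by simpa using hC x⟩
  | succ n ih =>
    obtain ⟨C, -, hC⟩ := h.exists_norm_le
    exact .of_fderiv (ih h.fderiv) (h.contDiff.differentiable (by simp)) hC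

end HasBoundedDerivFrom

theorem IsSubquadraticConfining.hasBoundedDerivFrom {d : ℕ} {V : EuclideanSpace ℝ (Fin d) → ℝ}
    (hV : IsSubquadraticConfining V) : HasBoundedDerivFrom 2 fun x => (V x : ℂ) :=
  HasBoundedDerivFrom.clm_comp ⟨hV.smooth, hV.bounded_deriv⟩ Complex.ofRealCLM

/-! ### The harmonic oscillator scale and elliptic regularity -/

section

open Laplacian

variable {d : ℕ}

/-- The partial derivative `∂_j` on tempered distributions. -/
noncomputable def partialDeriv (j : Fin d) :
    𝓢'(EuclideanSpace ℝ (Fin d), ℂ) →L[ℂ] 𝓢'(EuclideanSpace ℝ (Fin d), ℂ) :=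
  lineDerivOpCLM ℂ 𝓢'(EuclideanSpace ℝ (Fin d), ℂ) (EuclideanSpace.single j (1 : ℝ))

/-- Multiplication by the coordinate `x_j` on tempered distributions. -/
noncomputable def coordMul (j : Fin d) :
    𝓢'(EuclideanSpace ℝ (Fin d), ℂ) →L[ℂ] 𝓢'(EuclideanSpace ℝ (Fin d), ℂ) :=
  TemperedDistribution.smulLeftCLM ℂ
    (fun x => ((inner ℝ x (EuclideanSpace.single j (1 : ℝ)) : ℝ) : ℂ))

theorem partialDeriv_apply (j : Fin d) (T : 𝓢'(EuclideanSpace ℝ (Fin d), ℂ)) :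
    partialDeriv j T = ∂_{EuclideanSpace.single j (1 : ℝ)} T := rfl

theorem coordMul_apply (j : Fin d) (T : 𝓢'(EuclideanSpace ℝ (Fin d), ℂ)) :
    coordMul j T = TemperedDistribution.smulLeftCLM ℂ
      (fun x => ((inner ℝ x (EuclideanSpace.single j (1 : ℝ)) : ℝ) : ℂ)) T := rfl

theorem laplacian_eq_sum_partialDeriv (T : 𝓢'(EuclideanSpace ℝ (Fin d), ℂ)) :
    Δ T = ∑ i, partialDeriv i (partialDeriv i T) := laplacian_eq_sum_single T

theorem partialDeriv_comm (i j : Fin d) (T : 𝓢'(EuclideanSpace ℝ (Fin d), ℂ)) :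
    partialDeriv i (partialDeriv j T) = partialDeriv j (partialDeriv i T) := by
  simp only [partialDeriv_apply, TemperedDistribution.lineDeriv_eq_fourierMultiplierCLM, map_smul]
  rw [TemperedDistribution.fourierMultiplierCLM_fourierMultiplierCLM_apply
      (coord_hasTemperateGrowth j) (coord_hasTemperateGrowth i),
    TemperedDistribution.fourierMultiplierCLM_fourierMultiplierCLM_apply
      (coord_hasTemperateGrowth i) (coord_hasTemperateGrowth j),
    mul_comm (fun x => ((inner ℝ x (EuclideanSpace.single j (1 : ℝ)) : ℝ) : ℂ))]

theorem partialDeriv_laplacian (j : Fin d) (T : 𝓢'(EuclideanSpace ℝ (Fin d), ℂ)) :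
    partialDeriv j (Δ T) = Δ (partialDeriv j T) := by
  simp only [laplacian_eq_sum_partialDeriv, map_sum]
  refine Finset.sum_congr rfl fun i _ => ?_
  rw [partialDeriv_comm j i, partialDeriv_comm j i]

theorem coordMul_smulLeftCLM {m : EuclideanSpace ℝ (Fin d) → ℂ} (hm : m.HasTemperateGrowth)
    (j : Fin d) (T : 𝓢'(EuclideanSpace ℝ (Fin d), ℂ)) :
    coordMul j (TemperedDistribution.smulLeftCLM ℂ m T) =
      TemperedDistribution.smulLeftCLM ℂ m (coordMul j T) := by
  rw [coordMul_apply, coordMul_apply,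
    TemperedDistribution.smulLeftCLM_smulLeftCLM_apply hm (coord_hasTemperateGrowth j),
    TemperedDistribution.smulLeftCLM_smulLeftCLM_apply (coord_hasTemperateGrowth j) hm, mul_comm]

theorem partialDeriv_smulLeftCLM {n : ℕ} {m : EuclideanSpace ℝ (Fin d) → ℂ}
    (hm : HasBoundedDerivFrom n m) (j : Fin d) (T : 𝓢'(EuclideanSpace ℝ (Fin d), ℂ)) :
    partialDeriv j (TemperedDistribution.smulLeftCLM ℂ m T) =
      TemperedDistribution.smulLeftCLM ℂ m (partialDeriv j T) +
        TemperedDistribution.smulLeftCLM ℂ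
          (fun x => fderiv ℝ m x (EuclideanSpace.single j (1 : ℝ))) T :=
  TemperedDistribution.lineDerivOp_smulLeftCLM hm.hasTemperateGrowth _
    (hm.succ.fderiv_apply _).hasTemperateGrowth T

theorem partialDeriv_coordMul (i j : Fin d) (T : 𝓢'(EuclideanSpace ℝ (Fin d), ℂ)) :
    partialDeriv i (coordMul j T) = coordMul j (partialDeriv i T) + if i = j then T else 0 := by
  have hf : (fun x : EuclideanSpace ℝ (Fin d) => fderiv ℝ (fun y : EuclideanSpace ℝ (Fin d) =>
      ((inner ℝ y (EuclideanSpace.single j (1 : ℝ)) : ℝ) : ℂ)) x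
        (EuclideanSpace.single i (1 : ℝ))) = fun _ => if i = j then 1 else 0 := by
    ext x
    let L : EuclideanSpace ℝ (Fin d) →L[ℝ] ℂ :=
      Complex.ofRealCLM ∘L ((innerSL ℝ).flip (EuclideanSpace.single j (1 : ℝ)))
    change fderiv ℝ L x _ = _
    rw [L.fderiv]
    change ((inner ℝ (EuclideanSpace.single i (1 : ℝ)) (EuclideanSpace.single j (1 : ℝ)) : ℝ) : ℂ) =
      _
    simp [EuclideanSpace.inner_single_right, PiLp.single_apply, eq_comm, apply_ite]
  have := TemperedDistribution.lineDerivOp_smulLeftCLM (coord_hasTemperateGrowth j)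
    (EuclideanSpace.single i (1 : ℝ)) (by rw [hf]; fun_prop) T
  rw [hf, TemperedDistribution.smulLeftCLM_const] at this
  refine Eq.trans this ?_
  split_ifs
  · rw [one_smul]; rfl
  · rw [show (0 : ℂ) • T = 0 from zero_smul ℂ T]; rfl

/-- The commutator relation `[Δ, x_j] = 2∂_j`. -/
theorem laplacian_coordMul (j : Fin d) (T : 𝓢'(EuclideanSpace ℝ (Fin d), ℂ)) :
    Δ (coordMul j T) = coordMul j (Δ T) + (2 : ℂ) • partialDeriv j T := by
  have : ∀ i, partialDeriv i (partialDeriv i (coordMul j T)) =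
      coordMul j (partialDeriv i (partialDeriv i T)) +
        if i = j then (2 : ℂ) • partialDeriv j T else 0 := fun i => by
    rw [partialDeriv_coordMul, map_add, partialDeriv_coordMul]
    split_ifs with h
    · subst h; module
    · simp
  simp only [laplacian_eq_sum_partialDeriv, this, Finset.sum_add_distrib, map_sum,
    Finset.sum_ite_eq', Finset.mem_univ, if_true]

/-- The scale of spaces of the harmonic oscillator: the tempered distributions `T` for which every
product of at most `k` operators `∂_j` and `x_j` applied to `T` is in `L²`. -/
noncomputable def oscillatorSpace (d : ℕ) : ℕ → Submodule ℂ 𝓢'(EuclideanSpace ℝ (Fin d), ℂ)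
  | 0 => squareIntegrable d
  | k + 1 => oscillatorSpace d k ⊓
      ⨅ j : Fin d, (oscillatorSpace d k).comap (partialDeriv j).toLinearMap ⊓
        (oscillatorSpace d k).comap (coordMul j).toLinearMap

theorem mem_oscillatorSpace_succ {k : ℕ} {T : 𝓢'(EuclideanSpace ℝ (Fin d), ℂ)} :
    T ∈ oscillatorSpace d (k + 1) ↔ T ∈ oscillatorSpace d k ∧
      ∀ j, partialDeriv j T ∈ oscillatorSpace d k ∧ coordMul j T ∈ oscillatorSpace d k := by
  simp [oscillatorSpace, Submodule.mem_iInf]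

theorem norm_le_sum_inner (x : EuclideanSpace ℝ (Fin d)) :
    ‖x‖ ≤ ∑ j, ‖inner ℝ x (EuclideanSpace.single j (1 : ℝ))‖ := by
  conv_lhs => rw [← (EuclideanSpace.basisFun (Fin d) ℝ).sum_repr x]
  refine norm_sum_le_of_le _ fun j _ => ?_
  simp [norm_smul, EuclideanSpace.inner_single_right]

/-- Multiplication by a function with all derivatives bounded preserves the scale. -/
theorem smulLeftCLM_mem_oscillatorSpace {m : EuclideanSpace ℝ (Fin d) → ℂ}
    (hm : HasBoundedDerivFrom 0 m) {k : ℕ} {T : 𝓢'(EuclideanSpace ℝ (Fin d), ℂ)}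
    (hT : T ∈ oscillatorSpace d k) :
    TemperedDistribution.smulLeftCLM ℂ m T ∈ oscillatorSpace d k := by
  induction k generalizing m T with
  | zero =>
    obtain ⟨C, -, hC⟩ := hm.exists_norm_le
    exact smulLeftCLM_mem_squareIntegrable hm.hasTemperateGrowth (C := C)
      (fun x => by simpa using hC x) hT
  | succ k ih =>
    rw [mem_oscillatorSpace_succ] at hT ⊢
    refine ⟨ih hm hT.1, fun j => ⟨?_, ?_⟩⟩
    · rw [partialDeriv_smulLeftCLM hm]
      exact add_mem (ih hm (hT.2 j).1) (ih (hm.succ.fderiv_apply _) hT.1)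
    · rw [coordMul_smulLeftCLM hm.hasTemperateGrowth]
      exact ih hm (hT.2 j).2

/-- Multiplication by a function of linear growth costs one order in the scale of spaces of the
harmonic oscillator. -/
theorem smulLeftCLM_mem_oscillatorSpace_of_succ {m : EuclideanSpace ℝ (Fin d) → ℂ}
    (hm : HasBoundedDerivFrom 1 m) {k : ℕ} {T : 𝓢'(EuclideanSpace ℝ (Fin d), ℂ)}
    (hT : T ∈ oscillatorSpace d (k + 1)) :
    TemperedDistribution.smulLeftCLM ℂ m T ∈ oscillatorSpace d k := by
  induction k generalizing T with
  | zero =>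
    rw [mem_oscillatorSpace_succ] at hT
    obtain ⟨⟨u, rfl⟩, h⟩ := hT
    choose w hw using fun j => (h j).2
    obtain ⟨C, hC0, hC⟩ := hm.exists_norm_le
    have hu := Represents.toTemperedDistribution u
    have hwx : ∀ᵐ x, ∀ j, w j x =
        ((inner ℝ x (EuclideanSpace.single j (1 : ℝ)) : ℝ) : ℂ) * u x := by
      refine ae_all_iff.2 fun j => ?_
      have h1 := hu.smulLeftCLM (coord_hasTemperateGrowth j)
      rw [← coordMul_apply, show coordMul j (Lp.toTemperedDistribution u) =
        Lp.toTemperedDistribution (w j) from (hw j).symm] at h1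
      exact (Represents.toTemperedDistribution (w j)).ae_eq h1
    refine (hu.smulLeftCLM hm.hasTemperateGrowth).mem_squareIntegrable ?_
    have hg : MemLp (fun x => ‖u x‖ + ∑ j, ‖w j x‖) 2 :=
      (Lp.memLp u).norm.add (memLp_finsetSum _ fun j _ => (Lp.memLp (w j)).norm)
    refine hg.of_le_mul (c := C)
      (hm.contDiff.continuous.aestronglyMeasurable.mul (Lp.aestronglyMeasurable u)) ?_
    filter_upwards [hwx] with x hx
    rw [Real.norm_of_nonneg (by positivity), norm_mul]
    calc ‖m x‖ * ‖u x‖ ≤ C * (1 + ‖x‖) ^ 1 * ‖u x‖ := by gcongr; exact hC x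
      _ ≤ C * (1 + ∑ j, ‖inner ℝ x (EuclideanSpace.single j (1 : ℝ))‖) ^ 1 * ‖u x‖ := by
        gcongr; exact norm_le_sum_inner x
      _ = _ := by
        simp only [hx, norm_mul, Complex.norm_real, ← Finset.sum_mul]
        ring
  | succ k ih =>
    obtain ⟨h1, h2⟩ := mem_oscillatorSpace_succ.1 hT
    refine mem_oscillatorSpace_succ.2 ⟨ih h1, fun j => ⟨?_, ?_⟩⟩
    · rw [partialDeriv_smulLeftCLM hm]
      exact add_mem (ih (h2 j).1) (smulLeftCLM_mem_oscillatorSpace (hm.fderiv_apply _)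
        (mem_oscillatorSpace_succ.1 h1).1)
    · rw [coordMul_smulLeftCLM hm.hasTemperateGrowth]
      exact ih (h2 j).2

/-- The Schrödinger operator `-½Δ + V` on tempered distributions. -/
noncomputable def distSchrodinger (V : EuclideanSpace ℝ (Fin d) → ℝ)
    (T : 𝓢'(EuclideanSpace ℝ (Fin d), ℂ)) : 𝓢'(EuclideanSpace ℝ (Fin d), ℂ) :=
  -(1 / 2 : ℂ) • Δ T + TemperedDistribution.smulLeftCLM ℂ (fun x => (V x : ℂ)) T

variable {V : EuclideanSpace ℝ (Fin d) → ℝ}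

/-- The commutator relation `[H, x_j] = -∂_j`. -/
theorem distSchrodinger_coordMul (hV : IsSubquadraticConfining V) (j : Fin d)
    (T : 𝓢'(EuclideanSpace ℝ (Fin d), ℂ)) :
    distSchrodinger V (coordMul j T) = coordMul j (distSchrodinger V T) - partialDeriv j T := by
  rw [distSchrodinger, distSchrodinger, map_add, map_smul, laplacian_coordMul,
    coordMul_smulLeftCLM hV.hasBoundedDerivFrom.hasTemperateGrowth]
  module

/-- The commutator relation `[H, ∂_j] = -(∂_jV)`, where `∂_jV` grows at most linearly. -/
theorem distSchrodinger_partialDeriv (hV : IsSubquadraticConfining V) (j : Fin d)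
    (T : 𝓢'(EuclideanSpace ℝ (Fin d), ℂ)) :
    distSchrodinger V (partialDeriv j T) = partialDeriv j (distSchrodinger V T) -
      TemperedDistribution.smulLeftCLM ℂ
        (fun x => fderiv ℝ (fun y => (V y : ℂ)) x (EuclideanSpace.single j (1 : ℝ))) T := by
  rw [distSchrodinger, distSchrodinger, map_add, map_smul, ← partialDeriv_laplacian,
    partialDeriv_smulLeftCLM hV.hasBoundedDerivFrom]
  module

/-- Elliptic regularity in the scale of spaces of the harmonic oscillator, with the gain of one
order. Gaining one order only is what makes the induction close: applied to `∂_jT` and `x_jT`, the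
operator produces the commutators `(∂_jV)T` and `∂_jT`, which lie one step below `T` itself. -/
theorem mem_oscillatorSpace_succ_of_distSchrodinger (hV : IsSubquadraticConfining V) {k : ℕ}
    {T : 𝓢'(EuclideanSpace ℝ (Fin d), ℂ)} (hT : T ∈ oscillatorSpace d k)
    (hHT : distSchrodinger V T ∈ oscillatorSpace d k) : T ∈ oscillatorSpace d (k + 1) := by
  induction k generalizing T with
  | zero =>
    obtain ⟨δ, hδ, hVδ⟩ := hV.coercive
    exact mem_oscillatorSpace_succ.2 ⟨hT, fun j => gradient_coord_mem_squareIntegrable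
      hV.hasBoundedDerivFrom.hasTemperateGrowth hδ hVδ hT hHT j⟩
  | succ k ih =>
    have h1 := mem_oscillatorSpace_succ.1 hT
    have h2 := mem_oscillatorSpace_succ.1 hHT
    refine mem_oscillatorSpace_succ.2 ⟨hT, fun j => ⟨ih (h1.2 j).1 ?_, ih (h1.2 j).2 ?_⟩⟩
    · rw [distSchrodinger_partialDeriv hV]
      exact sub_mem (h2.2 j).1 (smulLeftCLM_mem_oscillatorSpace_of_succ
        (hV.hasBoundedDerivFrom.fderiv_apply _) hT)
    · rw [distSchrodinger_coordMul hV]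
      exact sub_mem (h2.2 j).2 (h1.2 j).1

end

/-! ### The Sobolev embedding and Schwartz functions -/

section

open FourierTransform Laplacian
open TemperedDistribution (MemSobolev besselPotential memSobolev_zero_iff
  memSobolev_besselPotential_iff)
open scoped Real

variable {d : ℕ}

/-- Fourier inversion for distributions whose Fourier transform is an integrable function. -/
theorem Represents.integral_fourierInv {v : EuclideanSpace ℝ (Fin d) → ℂ} (hv : Integrable v)
    {T : 𝓢'(EuclideanSpace ℝ (Fin d), ℂ)} (h : Represents v (𝓕 T)) :
    Continuous (𝓕⁻ v) ∧ (∀ x, ‖𝓕⁻ v x‖ ≤ ∫ ξ, ‖v ξ‖) ∧ Represents (𝓕⁻ v) T := by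
  have hL : Continuous fun p : EuclideanSpace ℝ (Fin d) × EuclideanSpace ℝ (Fin d) =>
      (-innerₗ (EuclideanSpace ℝ (Fin d))) p.1 p.2 := by
    simp only [LinearMap.neg_apply, innerₗ_apply_apply]
    fun_prop
  have hc : Continuous (𝓕⁻ v) :=
    VectorFourier.fourierIntegral_continuous Real.continuous_fourierChar hL hv
  have hb : ∀ x, ‖𝓕⁻ v x‖ ≤ ∫ ξ, ‖v ξ‖ := fun x =>
    VectorFourier.norm_fourierIntegral_le_integral_norm _ _ _ _ _
  refine ⟨hc, hb, hc.locallyIntegrable, fun φ => ?_, fun φ => ?_⟩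
  · exact φ.integrable.mul_bdd hc.aestronglyMeasurable (.of_forall hb)
  · have h1 : T φ = 𝓕 T (𝓕⁻ φ) := by simp
    rw [h1, h.apply_eq, SchwartzMap.fourierInv_coe]
    have h2 := VectorFourier.integral_fourierIntegral_smul_eq_flip (μ := volume) (ν := volume)
      Real.continuous_fourierChar hL φ.integrable hv
    have h3 : (-innerₗ (EuclideanSpace ℝ (Fin d))).flip = -innerₗ _ := by
      ext x y
      simp [real_inner_comm]
    rw [h3] at h2
    exact h2

/-- The tempered distributions which belong to all spaces of the harmonic oscillator scale. -/
noncomputable def oscillatorSmooth (d : ℕ) : Submodule ℂ 𝓢'(EuclideanSpace ℝ (Fin d), ℂ) :=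
  ⨅ k, oscillatorSpace d k

variable {T : 𝓢'(EuclideanSpace ℝ (Fin d), ℂ)}

theorem partialDeriv_mem_oscillatorSmooth (hT : T ∈ oscillatorSmooth d) (j : Fin d) :
    partialDeriv j T ∈ oscillatorSmooth d := by
  rw [oscillatorSmooth, Submodule.mem_iInf] at hT ⊢
  exact fun k => ((mem_oscillatorSpace_succ.1 (hT (k + 1))).2 j).1

theorem coordMul_mem_oscillatorSmooth (hT : T ∈ oscillatorSmooth d) (j : Fin d) :
    coordMul j T ∈ oscillatorSmooth d := by
  rw [oscillatorSmooth, Submodule.mem_iInf] at hT ⊢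
  exact fun k => ((mem_oscillatorSpace_succ.1 (hT (k + 1))).2 j).2

theorem memSobolev_of_mem_oscillatorSmooth (hT : T ∈ oscillatorSmooth d) (n : ℕ) :
    MemSobolev (2 * n) 2 T := by
  induction n generalizing T with
  | zero =>
    rw [oscillatorSmooth, Submodule.mem_iInf] at hT
    obtain ⟨u, hu⟩ := hT 0
    simpa using memSobolev_zero_iff.2 ⟨u, hu.symm⟩
  | succ n ih =>
    have h1 : besselPotential _ ℂ 2 T ∈ oscillatorSmooth d := by
      rw [besselPotential_two_eq, laplacian_eq_sum_partialDeriv]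
      exact sub_mem hT (Submodule.smul_mem _ _ (sum_mem fun j _ =>
        partialDeriv_mem_oscillatorSmooth (partialDeriv_mem_oscillatorSmooth hT j) j))
    have h2 := ih h1
    rw [memSobolev_besselPotential_iff] at h2
    convert h2 using 1
    push_cast
    ring

/-- Square integrability of sufficiently many derivatives makes the Fourier transform integrable. -/
theorem exists_fourier_memL1 (hT : T ∈ oscillatorSmooth d) :
    ∃ v : Lp ℂ 1 (volume : Measure (EuclideanSpace ℝ (Fin d))),
      𝓕 T = Lp.toTemperedDistribution v :=
  (memSobolev_of_mem_oscillatorSmooth hT (d + 1)).fourier_memL1 (by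
    rw [finrank_euclideanSpace_fin]; push_cast; linarith [(Nat.cast_nonneg d : (0 : ℝ) ≤ d)])

/-- The Sobolev embedding: elements of all spaces of the scale are bounded continuous functions. -/
theorem exists_continuous_represents (hT : T ∈ oscillatorSmooth d) :
    ∃ U : EuclideanSpace ℝ (Fin d) → ℂ,
      Continuous U ∧ (∃ C, ∀ x, ‖U x‖ ≤ C) ∧ Represents U T := by
  obtain ⟨v, hv⟩ := exists_fourier_memL1 hT
  obtain ⟨h1, h2, h3⟩ := Represents.integral_fourierInv (L1.integrable_coeFn v)
    (hv ▸ Represents.toTemperedDistribution v)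
  exact ⟨_, h1, ⟨_, h2⟩, h3⟩

theorem Represents.eq_of_continuous {U U' : EuclideanSpace ℝ (Fin d) → ℂ} (h : Represents U T)
    (h' : Represents U' T) (hc : Continuous U) (hc' : Continuous U') : U = U' :=
  (hc.ae_eq_iff_eq volume hc').1 (h.ae_eq h')

/-- The continuous representative is differentiable, and its partial derivatives are the continuous
representatives of the distributional ones. -/
theorem hasFDerivAt_of_represents (hT : T ∈ oscillatorSmooth d)
    {U : EuclideanSpace ℝ (Fin d) → ℂ} (hUc : Continuous U) (hU : Represents U T)
    {U' : Fin d → EuclideanSpace ℝ (Fin d) → ℂ} (hUc' : ∀ j, Continuous (U' j))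
    (hU' : ∀ j, Represents (U' j) (partialDeriv j T)) (x : EuclideanSpace ℝ (Fin d)) :
    HasFDerivAt U (∑ j, ContinuousLinearMap.smulRightL ℝ (EuclideanSpace ℝ (Fin d)) ℂ
      (innerSL ℝ (EuclideanSpace.single j (1 : ℝ))) (U' j x)) x := by
  obtain ⟨v, hv⟩ := exists_fourier_memL1 hT
  choose w hw using fun j => exists_fourier_memL1 (partialDeriv_mem_oscillatorSmooth hT j)
  have hvr : Represents v (𝓕 T) := hv ▸ Represents.toTemperedDistribution v
  have hwr : ∀ j, Represents (w j) (𝓕 (partialDeriv j T)) := fun j =>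
    (hw j) ▸ Represents.toTemperedDistribution (w j)
  have hwx : ∀ j, (w j) =ᵐ[volume] fun ξ => 2 * π * Complex.I *
      (((inner ℝ ξ (EuclideanSpace.single j (1 : ℝ)) : ℝ) : ℂ) * v ξ) := fun j => by
    have h1 := (hvr.smulLeftCLM (coord_hasTemperateGrowth j)).const_smul (2 * π * Complex.I)
    rw [← TemperedDistribution.fourier_lineDerivOp_eq] at h1
    exact (hwr j).ae_eq h1
  have hvi : Integrable v := L1.integrable_coeFn v
  have hU0 : U = 𝓕⁻ (v : EuclideanSpace ℝ (Fin d) → ℂ) := by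
    obtain ⟨h1, -, h3⟩ := Represents.integral_fourierInv hvi hvr
    exact hU.eq_of_continuous h3 hUc h1
  have hU0' : ∀ j, U' j = 𝓕⁻ (w j : EuclideanSpace ℝ (Fin d) → ℂ) := fun j => by
    obtain ⟨h1, -, h3⟩ := Represents.integral_fourierInv (L1.integrable_coeFn (w j)) (hwr j)
    exact (hU' j).eq_of_continuous h3 (hUc' j) h1
  -- `‖ξ‖ |v(ξ)| ≤ ∑_j |ξ_j v(ξ)| ≤ ∑_j |w_j(ξ)|`, so differentiation under the Fourier integral is
  -- allowed.
  have hvi' : Integrable fun ξ => ‖ξ‖ * ‖v ξ‖ := by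
    have h1 : Integrable fun ξ => ∑ j, ‖w j ξ‖ :=
      integrable_finsetSum _ fun j _ => (L1.integrable_coeFn (w j)).norm
    refine h1.mono' (continuous_norm.aestronglyMeasurable.mul hvi.1.norm) ?_
    filter_upwards [ae_all_iff.2 hwx] with ξ hξ
    rw [Real.norm_of_nonneg (by positivity)]
    simp only [hξ, norm_mul, ← Finset.mul_sum, Complex.norm_real, ← Finset.sum_mul]
    refine (mul_le_mul_of_nonneg_right (norm_le_sum_inner ξ) (norm_nonneg _)).trans
      (le_mul_of_one_le_left (by positivity) ?_)
    simp only [Complex.norm_ofNat, Complex.norm_I, mul_one, Real.norm_of_nonneg Real.pi_pos.le]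
    linarith [Real.pi_gt_three]
  let L := -innerSL ℝ (E := EuclideanSpace ℝ (Fin d))
  have hD := VectorFourier.hasFDerivAt_fourierIntegral L (μ := volume) hvi hvi' x
  have hS : Integrable (VectorFourier.fourierSMulRight L v) := by
    refine (hvi'.const_mul (2 * π * ‖L‖)).mono' hvi.1.fourierSMulRight (.of_forall fun ξ => ?_)
    rw [← mul_assoc]
    exact VectorFourier.norm_fourierSMulRight_le L v ξ
  -- Both sides of the formula for the derivative are linear; they are compared on the standard
  -- basis.
  have hE : VectorFourier.fourierIntegral Real.fourierChar volume L.toLinearMap₁₂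
        (VectorFourier.fourierSMulRight L v) x =
      ∑ j, ContinuousLinearMap.smulRightL ℝ (EuclideanSpace ℝ (Fin d)) ℂ
        (innerSL ℝ (EuclideanSpace.single j (1 : ℝ))) (U' j x) := by
    refine ContinuousLinearMap.coe_injective
      ((EuclideanSpace.basisFun (Fin d) ℝ).toBasis.ext fun i => ?_)
    simp only [OrthonormalBasis.coe_toBasis, EuclideanSpace.basisFun_apply,
      ContinuousLinearMap.coe_coe]
    rw [Real.fourierIntegral_continuousLinearMap_apply' hS]
    have h1 : (∑ j, ContinuousLinearMap.smulRightL ℝ (EuclideanSpace ℝ (Fin d)) ℂ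
        (innerSL ℝ (EuclideanSpace.single j (1 : ℝ))) (U' j x)) (EuclideanSpace.single i 1) =
        U' i x := by
      simp [EuclideanSpace.inner_single_left, PiLp.single_apply]
    rw [h1, hU0']
    refine integral_congr_ae ?_
    filter_upwards [hwx i] with ξ hξ
    rw [hξ]
    congr 1
    have hL : L ξ (EuclideanSpace.single i 1) = -inner ℝ ξ (EuclideanSpace.single i (1 : ℝ)) := rfl
    rw [VectorFourier.fourierSMulRight_apply, hL]
    simp only [Complex.real_smul, smul_eq_mul, Complex.ofReal_neg]
    ring
  rw [hE] at hD
  rw [hU0]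
  exact hD

theorem contDiff_of_represents (n : ℕ) (hT : T ∈ oscillatorSmooth d)
    {U : EuclideanSpace ℝ (Fin d) → ℂ} (hUc : Continuous U) (hU : Represents U T) :
    ContDiff ℝ n U := by
  induction n generalizing T U with
  | zero => exact contDiff_zero.2 hUc
  | succ n ih =>
    choose U' hUc' _ hU' using fun j =>
      exists_continuous_represents (partialDeriv_mem_oscillatorSmooth hT j)
    push_cast
    rw [contDiff_succ_iff_hasFDerivAt]
    refine ⟨_, ContDiff.sum fun j _ => ?_, hasFDerivAt_of_represents hT hUc hU hUc' hU'⟩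
    exact (ContinuousLinearMap.contDiff _).comp
      (ih (partialDeriv_mem_oscillatorSmooth hT j) (hUc' j) (hU' j))

theorem exists_pow_mul_norm_le (k : ℕ) (hT : T ∈ oscillatorSmooth d)
    {U : EuclideanSpace ℝ (Fin d) → ℂ} (hUc : Continuous U) (hU : Represents U T) :
    ∃ C, ∀ x, ‖x‖ ^ k * ‖U x‖ ≤ C := by
  induction k generalizing T U with
  | zero =>
    obtain ⟨U', hUc', ⟨C, hC⟩, hU'⟩ := exists_continuous_represents hT
    rw [hU.eq_of_continuous hU' hUc hUc']
    exact ⟨C, by simpa using hC⟩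
  | succ k ih =>
    choose C hC using fun j => ih (coordMul_mem_oscillatorSmooth hT j)
      ((coord_hasTemperateGrowth j).1.continuous.mul hUc)
      (hU.smulLeftCLM (coord_hasTemperateGrowth j))
    refine ⟨∑ j, C j, fun x => ?_⟩
    calc ‖x‖ ^ (k + 1) * ‖U x‖ = ‖x‖ * (‖x‖ ^ k * ‖U x‖) := by ring
      _ ≤ (∑ j, ‖inner ℝ x (EuclideanSpace.single j (1 : ℝ))‖) * (‖x‖ ^ k * ‖U x‖) := by
        gcongr; exact norm_le_sum_inner x
      _ = ∑ j, ‖x‖ ^ k * ‖((inner ℝ x (EuclideanSpace.single j (1 : ℝ)) : ℝ) : ℂ) * U x‖ := by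
        rw [Finset.sum_mul]
        refine Finset.sum_congr rfl fun j _ => ?_
        rw [norm_mul, Complex.norm_real]
        ring
      _ ≤ ∑ j, C j := Finset.sum_le_sum fun j _ => hC j x

theorem exists_pow_mul_norm_iteratedFDeriv_le (k n : ℕ) (hT : T ∈ oscillatorSmooth d)
    {U : EuclideanSpace ℝ (Fin d) → ℂ} (hUc : Continuous U) (hU : Represents U T) :
    ∃ C, ∀ x, ‖x‖ ^ k * ‖iteratedFDeriv ℝ n U x‖ ≤ C := by
  induction n generalizing T U with
  | zero => simpa only [norm_iteratedFDeriv_zero] using exists_pow_mul_norm_le k hT hUc hU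
  | succ n ih =>
    choose U' hUc' _ hU' using fun j =>
      exists_continuous_represents (partialDeriv_mem_oscillatorSmooth hT j)
    choose C hC using fun j => ih (partialDeriv_mem_oscillatorSmooth hT j) (hUc' j) (hU' j)
    have hd : fderiv ℝ U = fun x => ∑ j, ContinuousLinearMap.smulRightL ℝ
        (EuclideanSpace ℝ (Fin d)) ℂ (innerSL ℝ (EuclideanSpace.single j (1 : ℝ))) (U' j x) :=
      funext fun x => (hasFDerivAt_of_represents hT hUc hU hUc' hU' x).fderiv
    have hcd : ∀ j, ContDiff ℝ n (U' j) := fun j =>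
      contDiff_of_represents n (partialDeriv_mem_oscillatorSmooth hT j) (hUc' j) (hU' j)
    have hcc : ∀ j, ContDiff ℝ n fun x => ContinuousLinearMap.smulRightL ℝ
        (EuclideanSpace ℝ (Fin d)) ℂ (innerSL ℝ (EuclideanSpace.single j (1 : ℝ))) (U' j x) :=
      fun j => (ContinuousLinearMap.contDiff _).comp (hcd j)
    refine ⟨∑ j, ‖ContinuousLinearMap.smulRightL ℝ (EuclideanSpace ℝ (Fin d)) ℂ
      (innerSL ℝ (EuclideanSpace.single j (1 : ℝ)))‖ * C j, fun x => ?_⟩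
    rw [← norm_iteratedFDeriv_fderiv, hd,
      iteratedFDeriv_fun_sum_apply fun j _ => (hcc j).contDiffAt]
    refine (mul_le_mul_of_nonneg_left (norm_sum_le _ _) (by positivity)).trans ?_
    rw [Finset.mul_sum]
    refine Finset.sum_le_sum fun j _ => ?_
    refine (mul_le_mul_of_nonneg_left (ContinuousLinearMap.norm_iteratedFDeriv_comp_left _
      (hcd j).contDiffAt le_rfl) (by positivity)).trans ?_
    rw [mul_left_comm]
    exact mul_le_mul_of_nonneg_left (hC j x) (norm_nonneg _)

/-- The intersection of the harmonic oscillator scale consists of Schwartz functions. -/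
theorem exists_schwartzMap_of_mem_oscillatorSmooth {u : L2Space d}
    (hu : Lp.toTemperedDistribution u ∈ oscillatorSmooth d) :
    ∃ φ : 𝓢(EuclideanSpace ℝ (Fin d), ℂ), φ.toLp 2 volume = u := by
  obtain ⟨U, hUc, -, hU⟩ := exists_continuous_represents hu
  let φ : 𝓢(EuclideanSpace ℝ (Fin d), ℂ) :=
    { toFun := U
      smooth' := contDiff_infty.2 fun n => contDiff_of_represents n hu hUc hU
      decay' := fun k n => exists_pow_mul_norm_iteratedFDeriv_le k n hu hUc hU }
  refine ⟨φ, Lp.ext ((φ.coeFn_toLp 2 volume).trans ?_)⟩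
  exact hU.ae_eq (Represents.toTemperedDistribution u)

end

/-! ### The operator of the form and the distributional operator -/

section

open Laplacian

variable {d : ℕ} {V : EuclideanSpace ℝ (Fin d) → ℝ}

theorem conjSchwartz_lineDerivOp (φ : 𝓢(EuclideanSpace ℝ (Fin d), ℂ))
    (m : EuclideanSpace ℝ (Fin d)) : conjSchwartz (∂_{m} φ) = ∂_{m} (conjSchwartz φ) := by
  ext x
  rw [conjSchwartz_apply, lineDerivOp_apply_eq_fderiv, lineDerivOp_apply_eq_fderiv]
  have h := (Complex.conjCLE : ℂ →L[ℝ] ℂ).hasFDerivAt.comp x (φ.hasFDerivAt (x := x))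
  rw [show (conjSchwartz φ : EuclideanSpace ℝ (Fin d) → ℂ) =
    (Complex.conjCLE : ℂ →L[ℝ] ℂ) ∘ φ from rfl, h.fderiv]
  rfl

/-- The operator `-½Δ + V` on Schwartz functions. -/
noncomputable def schwartzSchrodinger (V : EuclideanSpace ℝ (Fin d) → ℝ)
    (φ : 𝓢(EuclideanSpace ℝ (Fin d), ℂ)) : 𝓢(EuclideanSpace ℝ (Fin d), ℂ) :=
  -(1 / 2 : ℂ) • (∑ j : Fin d, ∂_{EuclideanSpace.single j (1 : ℝ)}
      (∂_{EuclideanSpace.single j (1 : ℝ)} φ)) +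
    SchwartzMap.smulLeftCLM ℂ (fun x => (V x : ℂ)) φ

theorem distSchrodinger_apply (T : 𝓢'(EuclideanSpace ℝ (Fin d), ℂ))
    (φ : 𝓢(EuclideanSpace ℝ (Fin d), ℂ)) :
    distSchrodinger V T φ = T (schwartzSchrodinger V φ) := by
  have h : (∑ j : Fin d, ∂_{EuclideanSpace.single j (1 : ℝ)}
      (∂_{EuclideanSpace.single j (1 : ℝ)} φ)) = Δ φ := by
    simpa using (SchwartzMap.laplacian_eq_sum (EuclideanSpace.basisFun (Fin d) ℝ) φ).symm
  rw [schwartzSchrodinger, h, map_add, map_smul, ← TemperedDistribution.laplacian_apply_apply]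
  rfl

theorem conjSchwartz_schwartzSchrodinger
    (hV : (fun x => (V x : ℂ)).HasTemperateGrowth) (φ : 𝓢(EuclideanSpace ℝ (Fin d), ℂ)) :
    conjSchwartz (schwartzSchrodinger V φ) = schwartzSchrodinger V (conjSchwartz φ) := by
  ext x
  simp only [schwartzSchrodinger, ← conjSchwartz_lineDerivOp]
  simp [conjSchwartz_apply, SchwartzMap.smulLeftCLM_apply_apply hV, sum_apply]
  exact Or.inl (map_ofNat _ 2)

/-- Schwartz functions belong to the form domain of a potential of temperate growth. -/
theorem toLp_mem_formDomain_of_hasTemperateGrowth (hV : (fun x => (V x : ℂ)).HasTemperateGrowth)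
    (φ : 𝓢(EuclideanSpace ℝ (Fin d), ℂ)) : φ.toLp 2 volume ∈ formDomain V := by
  refine ⟨?_, ?_⟩
  · rw [SetLike.mem_coe, Submodule.mem_iInf]
    intro j
    refine LinearPMap.mem_domain_of_mem_graph
      (y := (∂_{EuclideanSpace.single j (1 : ℝ)} φ).toLp 2 volume) ?_
    rw [weakPartial_graph, mem_weakPartialGraph, Lp.toTemperedDistributionCLM_apply,
      Lp.toTemperedDistributionCLM_apply, Lp.toTemperedDistribution_toLp_eq,
      Lp.toTemperedDistribution_toLp_eq]
    exact TemperedDistribution.lineDerivOp_toTemperedDistributionCLM_eq φ _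
  · have hVc : Continuous V := by
      have := Complex.continuous_re.comp hV.1.continuous
      simpa [Function.comp_def] using this
    have hm : MemLp (fun x => ((√(V x) : ℝ) : ℂ) * φ x) 2 volume := by
      -- As `√V ≤ 1 + |V|`, the product `√V φ` is dominated by the Schwartz functions `φ` and `Vφ`.
      have h1 : MemLp (fun x => ‖φ x‖ + ‖SchwartzMap.smulLeftCLM ℂ (fun x => (V x : ℂ)) φ x‖) 2 :=
        (φ.memLp 2).norm.add ((SchwartzMap.smulLeftCLM ℂ (fun x => (V x : ℂ)) φ).memLp 2).norm
      refine h1.of_le (by have := φ.continuous; fun_prop) (.of_forall fun x => ?_)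
      rw [Real.norm_of_nonneg (by positivity), SchwartzMap.smulLeftCLM_apply_apply hV, smul_eq_mul,
        norm_mul, norm_mul, Complex.norm_real, Complex.norm_real, ← one_add_mul,
        Real.norm_of_nonneg (Real.sqrt_nonneg _)]
      gcongr
      refine Real.sqrt_le_iff.2 ⟨by positivity, ?_⟩
      nlinarith [Real.le_norm_self (V x), norm_nonneg (V x)]
    refine LinearPMap.mem_domain_of_mem_graph (y := hm.toLp _) ?_
    rw [mulOperator_graph, mem_mulGraph]
    filter_upwards [hm.coeFn_toLp, φ.coeFn_toLp 2 volume] with x h1 h2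
    rw [h1, h2]

theorem lineDerivOp_eq_formPartial (u : formDomain V) (j : Fin d) :
    ∂_{EuclideanSpace.single j (1 : ℝ)} (Lp.toTemperedDistribution (u : L2Space d)) =
      Lp.toTemperedDistribution (formPartial V j u) := by
  have h := (weakPartial j).mem_graph (Submodule.inclusion
    (inf_le_left.trans (iInf_le (fun j => (weakPartial j).domain) j)) u)
  rw [weakPartial_graph] at h
  exact h

theorem formSqrtPotential_ae_eq (u : formDomain V) :
    ∀ᵐ x, formSqrtPotential V u x = (√(V x) : ℝ) * (u : L2Space d) x := by
  have h := (mulOperator fun x => √(V x)).mem_graph (Submodule.inclusion inf_le_right u)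
  rw [mulOperator_graph] at h
  exact h

/-- Against a Schwartz function the quadratic form is the distributional Schrödinger operator. -/
theorem energyForm_schwartz (hV0 : ∀ x, 0 ≤ V x) (hV : (fun x => (V x : ℂ)).HasTemperateGrowth)
    (φ : 𝓢(EuclideanSpace ℝ (Fin d), ℂ)) (u : formDomain V) :
    energyForm V ⟨φ.toLp 2 volume, toLp_mem_formDomain_of_hasTemperateGrowth hV φ⟩ u =
      distSchrodinger V (Lp.toTemperedDistribution (u : L2Space d)) (conjSchwartz φ) := by
  set v : formDomain V := ⟨φ.toLp 2 volume, toLp_mem_formDomain_of_hasTemperateGrowth hV φ⟩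
  have h1 : ∀ j, formPartial V j v = (∂_{EuclideanSpace.single j (1 : ℝ)} φ).toLp 2 volume :=
    fun j => by
      refine toTemperedDistribution_injective ?_
      rw [← lineDerivOp_eq_formPartial, Lp.toTemperedDistribution_toLp_eq,
        Lp.toTemperedDistribution_toLp_eq]
      exact TemperedDistribution.lineDerivOp_toTemperedDistributionCLM_eq φ _
  have h2 : inner ℂ (formSqrtPotential V v) (formSqrtPotential V u) =
      TemperedDistribution.smulLeftCLM ℂ (fun x => (V x : ℂ))
        (Lp.toTemperedDistribution (u : L2Space d)) (conjSchwartz φ) := by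
    rw [((Represents.toTemperedDistribution (u : L2Space d)).smulLeftCLM hV).apply_eq, L2.inner_def]
    refine integral_congr_ae ?_
    filter_upwards [formSqrtPotential_ae_eq v, formSqrtPotential_ae_eq u,
      φ.coeFn_toLp 2 volume] with x hx hx' hx''
    have hs : (V x : ℂ) = (√(V x) : ℝ) * (√(V x) : ℝ) := by
      rw [← Complex.ofReal_mul, Real.mul_self_sqrt (hV0 x)]
    rw [hx, hx', RCLike.inner_apply, hs, conjSchwartz_apply, map_mul, Complex.conj_ofReal]
    rw [show ((v : L2Space d) : EuclideanSpace ℝ (Fin d) → ℂ) x = φ x from hx'']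
    ring
  have h3 : ∀ j, inner ℂ (formPartial V j v) (formPartial V j u) =
      -(∂_{EuclideanSpace.single j (1 : ℝ)} (∂_{EuclideanSpace.single j (1 : ℝ)}
        (Lp.toTemperedDistribution (u : L2Space d)))) (conjSchwartz φ) := fun j => by
    rw [h1, inner_toLp_eq, ← lineDerivOp_eq_formPartial, conjSchwartz_lineDerivOp,
      TemperedDistribution.lineDerivOp_apply_apply (∂_{EuclideanSpace.single j (1 : ℝ)} _),
      map_neg, neg_neg]
  rw [energyForm, h2, Finset.sum_congr rfl fun j _ => h3 j, distSchrodinger,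
    laplacian_eq_sum_single, add_apply, smul_apply, sum_apply, Finset.sum_neg_distrib, smul_eq_mul]
  ring

/-- On its domain the form operator acts as the distributional Schrödinger operator: Schwartz
functions are admissible in the form identity. -/
theorem distSchrodinger_eq_of_mem_graph (hV0 : ∀ x, 0 ≤ V x)
    (hV : (fun x => (V x : ℂ)).HasTemperateGrowth) {u w : L2Space d}
    (h : (u, w) ∈ schrodingerGraph V) :
    distSchrodinger V (Lp.toTemperedDistribution u) = Lp.toTemperedDistribution w := by
  obtain ⟨hu, h⟩ := h
  ext φ
  have := h ⟨_, toLp_mem_formDomain_of_hasTemperateGrowth hV (conjSchwartz φ)⟩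
  rwa [energyForm_schwartz hV0 hV, inner_toLp_eq, conjSchwartz_conjSchwartz] at this

theorem conj_energyForm (u v : formDomain V) :
    starRingEnd ℂ (energyForm V u v) = energyForm V v u := by
  simp [energyForm, inner_conj_symm]
  exact Or.inl (map_ofNat _ 2)

/-- Schwartz functions are in the domain of the form operator, which maps them to Schwartz
functions. -/
theorem schwartz_mem_schrodingerGraph (hV0 : ∀ x, 0 ≤ V x)
    (hV : (fun x => (V x : ℂ)).HasTemperateGrowth) (φ : 𝓢(EuclideanSpace ℝ (Fin d), ℂ)) :
    (φ.toLp 2 volume, (schwartzSchrodinger V φ).toLp 2 volume) ∈ schrodingerGraph V := by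
  refine ⟨toLp_mem_formDomain_of_hasTemperateGrowth hV φ, fun v => ?_⟩
  rw [← conj_energyForm, energyForm_schwartz hV0 hV, distSchrodinger_apply,
    ← conjSchwartz_schwartzSchrodinger hV, ← inner_toLp_eq, inner_conj_symm]

end

theorem mainTheorem11 (d : ℕ) (V : EuclideanSpace ℝ (Fin d) → ℝ)
    (hV : IsSubquadraticConfining V) :
    (⨅ n : ℕ, powDomain (schrodingerOperator V) n) =
      LinearMap.range (SchwartzMap.toLpCLM ℂ ℂ 2
        (volume : Measure (EuclideanSpace ℝ (Fin d)))).toLinearMap := by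
  have hVg := hV.hasBoundedDerivFrom.hasTemperateGrowth
  have hgraph := schrodingerOperator_graph hV.smooth.continuous
  apply le_antisymm
  · have hstep : ∀ u ∈ ⨅ n : ℕ, powDomain (schrodingerOperator V) n,
        ∃ w ∈ ⨅ n : ℕ, powDomain (schrodingerOperator V) n,
          distSchrodinger V (Lp.toTemperedDistribution u) = Lp.toTemperedDistribution w := by
      intro u hu
      rw [Submodule.mem_iInf] at hu
      obtain ⟨hd, -⟩ := (mem_powDomain_succ _ 0 u).1 (hu 1)
      refine ⟨schrodingerOperator V ⟨u, hd⟩, ?_, ?_⟩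
      · exact (Submodule.mem_iInf _).2 fun n => ((mem_powDomain_succ _ n u).1 (hu (n + 1))).2
      · exact distSchrodinger_eq_of_mem_graph hV.nonneg hVg
          (hgraph ▸ (schrodingerOperator V).mem_graph ⟨u, hd⟩)
    -- The space of smooth vectors is stable under the operator, so elliptic regularity can be applied
    -- to `u` and to its image at every order.
    have hreg : ∀ k, ∀ u ∈ ⨅ n : ℕ, powDomain (schrodingerOperator V) n,
        Lp.toTemperedDistribution u ∈ oscillatorSpace d k := by
      intro k
      induction k with
      | zero => exact fun u _ => toTemperedDistribution_mem u
      | succ k ih =>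
        intro u hu
        obtain ⟨w, hw, he⟩ := hstep u hu
        exact mem_oscillatorSpace_succ_of_distSchrodinger hV (ih u hu) (he ▸ ih w hw)
    intro u hu
    obtain ⟨φ, hφ⟩ := exists_schwartzMap_of_mem_oscillatorSmooth
      ((Submodule.mem_iInf _).2 fun k => hreg k u hu)
    exact ⟨φ, hφ⟩
  · rintro _ ⟨φ, rfl⟩
    refine (Submodule.mem_iInf _).2 fun n => ?_
    induction n generalizing φ with
    | zero => exact Submodule.mem_top
    | succ n ih =>
      have hφ := schwartz_mem_schrodingerGraph hV.nonneg hVg φ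
      rw [← hgraph, LinearPMap.mem_graph_iff] at hφ
      obtain ⟨y, hy1, hy2⟩ := hφ
      have hd : φ.toLp 2 volume ∈ (schrodingerOperator V).domain := by
        have := y.2
        rwa [hy1] at this
      refine (mem_powDomain_succ _ n _).2 ⟨hd, ?_⟩
      have : schrodingerOperator V ⟨φ.toLp 2 volume, hd⟩ =
          (schwartzSchrodinger V φ).toLp 2 volume := by
        refine Eq.trans ?_ hy2
        congr 1
        exact Subtype.ext hy1.symm
      exact this ▸ ih (schwartzSchrodinger V φ)
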